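/- **Setting.** A category is *homological* if it is pointed, finitely complete, regular and protomodular (i.e. the Split Short Five Lemma holds); it is *semi-abelian* if moreover it is Barr-exact and has binary coproducts. Let $$\mathcal F \underset{U}{\overset{F}{\leftrightarrows}} \mathcal B \underset{H}{\overset{I}{\leftrightarrows}} \mathcal A,\qquad F\dashv U,\quad I\dashv H,$$ where $\mathcal A$ is semi-abelian, $H$ and $U$ are inclusions of full (replete) subcategories, and * $\mathcal B$ is a Birkhoff subcategory of $\mathcal A$: the components of the unit $\eta^1$ of $I\dashv H$ are regular epimorphisms in $\mathcal A$, and $\mathcal B$ is closed under regular quotients in $\mathcal A$; * $\mathcal F$ is regular epi-reflective in $\mathcal B$: the components of the unit $\eta^2$ of $F\dashv U$ are regular epimorphisms in $\mathcal B$; * $\mathcal F$ is admissible in $\mathcal B$ for regular epimorphisms: for every $X\in\mathcal B$ and every $\varphi\colon Y\to F(X)$ in $\mathcal F$ such that $U(\varphi)$ is a regular epimorphism in $\mathcal B$, the canonical morphism $F(X\times_{UF(X)}U(Y))\to FU(Y)\to Y$ is an isomorphism; * $F$ is protoadditive: it preserves split short exact sequences. Write $\eta$ for the unit of the composite adjunction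 $F\circ I\dashv H\circ U$, and $K[g]$ for the kernel of a morphism $g$. **Fundamental group.** An *$\mathcal F$-trivial extension* is a regular epimorphism $g\colon E\to B$ in $\mathcal A$ whose naturality square for $\eta$ is a pullback. A *monadic extension* is a regular epimorphism $p\colon E\to B$ in $\mathcal A$ such that pulling back along $p$ is a monadic functor from the regular epimorphisms over $B$ to the regular epimorphisms over $E$ (full subcategories of the slices). An *$\mathcal F$-normal extension* is a monadic extension $p\colon E\to B$ such that the kernel pair projection $E\times_BE\to E$ is an $\mathcal F$-trivial extension. It is *weakly universal* if for every $\mathcal F$-normal extension $p'\colon E'\to B$ there is $u\colon E\to E'$ with $p'u=p$. The fundamental group $\pi_1(B)$ is (the underlying object of) the Galois group $$\mathrm{Gal}(E,p,0)=\ker\big(\langle FI(\pi_1),FI(\pi_2)\rangle\colon FI(E\times_BE)\to FI(E)\times FI(E)\big)$$ of a weakly universal $\mathcal F$-normal extension $p\colon E\to B$. **Closure and commutator.** For a normal subobject $N$ of $A\in\mathcal A$ with quotient map $q\colon A\to A/N$, its homological closure is $\overline{N}^{\mathcal F}_A=q^{-1}(K[\eta_{A/N}])$. For a regular epimorphism $f\colon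 A\to B$ in $\mathcal A$ with kernel pair projections $\pi_1,\pi_2\colon R[f]\to A$, the relative commutator $[K[f],A]_{\mathcal B}$ is the kernel of the restriction $K[\eta^1_{R[f]}]\to K[\eta^1_A]$ of $\pi_1$; it is a subobject of $A$ through $\pi_2$, contained and normal in $K[f]$. For $f\colon A\to 0$ this gives $[A,A]_{\mathcal B}$, a normal subobject of $A$. **Theorem.** Let $f\colon P\to B$ be a projective presentation in $\mathcal A$, that is, a regular epimorphism whose domain $P$ is projective with respect to regular epimorphisms. Then $B$ has a weakly universal $\mathcal F$-normal extension, the subobject $\overline{([K[f],P]_{\mathcal B})}^{\mathcal F}_{K[f]}$ is contained and normal in $K[f]\wedge\overline{([P,P]_{\mathcal B})}^{\mathcal F}_{P}$, and for every weakly universal $\mathcal F$-normal extension of $B$ (that is, whichever one is used to define $\pi_1(B)$) $$\pi_1(B)\;\cong\;\frac{K[f]\wedge\overline{([P,P]_{\mathcal B})}^{\mathcal F}_{P}}{\overline{([K[f],P]_{\mathcal B})}^{\mathcal F}_{K[f]}}$$ in $\mathcal A$. -/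

import Mathlib

open CategoryTheory CategoryTheory.Limits

universe v₁ v₂ u₁ u₂

namespace SemiAbelianHopf

noncomputable section

section Exactness

variable {C : Type u₁} [Category.{v₁} C] [HasZeroMorphisms C]

/-- A normal monomorphism: a kernel of some morphism. -/
class IsNormalMono {K A : C} (k : K ⟶ A) : Prop where
  normalMono : Nonempty (NormalMono k)

/-- A short exact sequence `0 ⟶ K ⟶ A ⟶ B ⟶ 0`: `k` is a kernel of `f` and `f` is a cokernel
of `k`. -/
structure IsShortExact {K A B : C} (k : K ⟶ A) (f : A ⟶ B) : Prop where
  w : k ≫ f = 0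
  isKernel : Nonempty (IsLimit (KernelFork.ofι k w))
  isCokernel : Nonempty (IsColimit (CokernelCofork.ofπ f w))

/-- A split short exact sequence, with chosen splitting `s`. -/
structure IsSplitShortExact {K A B : C} (k : K ⟶ A) (f : A ⟶ B) (s : B ⟶ A) : Prop
    extends IsShortExact k f where
  splitting : s ≫ f = 𝟙 B

variable (C) in
/-- The Split Short Five Lemma: in a morphism between two split epimorphisms with chosen sections
and kernels, the middle component is invertible as soon as the outer ones are. -/
def SplitShortFiveLemma : Prop :=
  ∀ ⦃K A B K' A' B' : C⦄ (k : K ⟶ A) (f : A ⟶ B) (s : B ⟶ A)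
    (k' : K' ⟶ A') (f' : A' ⟶ B') (s' : B' ⟶ A') (u : K ⟶ K') (v : A ⟶ A') (w : B ⟶ B')
    (hk : k ≫ f = 0) (hk' : k' ≫ f' = 0),
    Nonempty (IsLimit (KernelFork.ofι k hk)) → Nonempty (IsLimit (KernelFork.ofι k' hk')) →
    s ≫ f = 𝟙 B → s' ≫ f' = 𝟙 B' →
    k ≫ v = u ≫ k' → f ≫ w = v ≫ f' → s ≫ v = w ≫ s' →
    IsIso u → IsIso w → IsIso v

variable (C) in
/-- A homological category: pointed, finitely complete, regular and protomodular. For a pointed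
finitely complete category protomodularity is the Split Short Five Lemma. -/
class Homological : Prop extends Regular C, HasZeroObject C where
  splitShortFive : SplitShortFiveLemma C

variable (C) in
/-- A semi-abelian category: homological, Barr-exact, with binary coproducts. -/
class SemiAbelian : Prop extends Homological C, HasBinaryCoproducts C where
  effective : ∀ ⦃R X : C⦄ (p₁ p₂ : R ⟶ X),
    IsEquivalenceRelation p₁ p₂ → IsEffectiveEquivalenceRelation p₁ p₂

/-- In a homological category a regular epimorphism identifies every map that kills its kernel. -/
theorem regularEpi_desc_condition [Homological C] {A B : C} (f : A ⟶ B) {K : C} (k : K ⟶ A)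
    (hk : k ≫ f = 0) (hlim : IsLimit (KernelFork.ofι k hk)) {Z : C} (g : A ⟶ Z)
    (hg : k ≫ g = 0) : pullback.fst f f ≫ g = pullback.snd f f ≫ g := by
  let j : K ⟶ pullback f f := pullback.lift 0 k (by simp [hk])
  let d : A ⟶ pullback f f := pullback.lift (𝟙 A) (𝟙 A) rfl
  let e := equalizer.ι (pullback.fst f f ≫ g) (pullback.snd f f ≫ g)
  let j' : K ⟶ equalizer (pullback.fst f f ≫ g) (pullback.snd f f ≫ g) :=
    equalizer.lift j (by
      rw [← Category.assoc, ← Category.assoc, pullback.lift_fst, pullback.lift_snd, hg,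
        zero_comp])
  let d' : A ⟶ equalizer (pullback.fst f f ≫ g) (pullback.snd f f ≫ g) :=
    equalizer.lift d (by
      rw [← Category.assoc, ← Category.assoc, pullback.lift_fst, pullback.lift_snd])
  have hj'e : j' ≫ e = j := equalizer.lift_ι _ _
  have hd'e : d' ≫ e = d := equalizer.lift_ι _ _
  have hj : j ≫ pullback.fst f f = 0 := pullback.lift_fst _ _ _
  have hjs : j ≫ pullback.snd f f = k := pullback.lift_snd _ _ _
  have hmk : Mono k := mono_of_isLimit_fork hlim
  have hmj : Mono j := by
    have : Mono (j ≫ pullback.snd f f) := by rw [hjs]; infer_instance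
    exact mono_of_mono j (pullback.snd f f)
  have hmj' : Mono j' := by
    have : Mono (j' ≫ e) := by rw [hj'e]; infer_instance
    exact mono_of_mono j' e
  have hw : j' ≫ (e ≫ pullback.fst f f) = 0 := by rw [← Category.assoc, hj'e, hj]
  have key : ∀ {T : C} (t : T ⟶ pullback f f), t ≫ pullback.fst f f = 0 →
      ∃ l : T ⟶ K, l ≫ j = t := by
    intro T t ht
    have h1 : (t ≫ pullback.snd f f) ≫ f = 0 := by
      rw [Category.assoc, ← pullback.condition, ← Category.assoc, ht, zero_comp]
    obtain ⟨l, hl⟩ := KernelFork.IsLimit.lift' hlim _ h1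
    refine ⟨l, pullback.hom_ext ?_ ?_⟩
    · rw [Category.assoc, hj, comp_zero, ht]
    · rw [Category.assoc, hjs]; exact hl
  have lim : IsLimit (KernelFork.ofι j hj) :=
    KernelFork.IsLimit.ofι' j hj fun t ht =>
      ⟨(key t ht).choose, (key t ht).choose_spec⟩
  have lim' : IsLimit (KernelFork.ofι j' hw) :=
    KernelFork.IsLimit.ofι' j' hw fun t ht => by
      have h := key (t ≫ e) (by rw [Category.assoc]; exact ht)
      refine ⟨h.choose, ?_⟩
      rw [← cancel_mono e, Category.assoc, hj'e]
      exact h.choose_spec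
  have hiso : IsIso e :=
    Homological.splitShortFive j' (e ≫ pullback.fst f f) d' j (pullback.fst f f) d (𝟙 K) e (𝟙 A)
      hw hj ⟨lim'⟩ ⟨lim⟩ (by rw [← Category.assoc, hd'e]; exact pullback.lift_fst _ _ _)
      (pullback.lift_fst _ _ _) (by rw [hj'e, Category.id_comp]) (by simp)
      (by rw [hd'e, Category.id_comp]) inferInstance inferInstance
  rw [← cancel_epi e]
  exact equalizer.condition _ _

/-- In a homological category every normal subobject `K` of `A` has a quotient `A ⟶ A/K`. -/
instance hasCokernel_of_isNormalMono [Homological C] {K A : C} (k : K ⟶ A) [h : IsNormalMono k] :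
    HasCokernel k := by
  obtain ⟨N⟩ := h.normalMono
  let φ := Regular.strongEpiMonoFactorisation N.g
  have hke : k ≫ φ.e = 0 := by
    rw [← cancel_mono φ.m, Category.assoc, φ.fac, zero_comp]; exact N.w
  have lim : IsLimit (KernelFork.ofι k hke) :=
    have : Mono k := mono_of_isLimit_fork N.isLimit
    KernelFork.IsLimit.ofι' k hke fun t ht =>
      KernelFork.IsLimit.lift' N.isLimit t (by rw [← φ.fac, ← Category.assoc, ht, zero_comp])
  have hreg : IsRegularEpi φ.e := inferInstance
  obtain ⟨r⟩ := hreg.regularEpi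
  have := r.epi
  have col : IsColimit (CokernelCofork.ofπ φ.e hke) :=
    CokernelCofork.IsColimit.ofπ' φ.e hke fun g hg =>
      Cofork.IsColimit.desc' r.isColimit g (by
        have hc := regularEpi_desc_condition φ.e k hke lim g hg
        have h1 : pullback.lift r.left r.right r.w ≫ pullback.fst φ.e φ.e = r.left :=
          pullback.lift_fst _ _ _
        have h2 : pullback.lift r.left r.right r.w ≫ pullback.snd φ.e φ.e = r.right :=
          pullback.lift_snd _ _ _
        calc r.left ≫ g = (pullback.lift r.left r.right r.w ≫ pullback.fst φ.e φ.e) ≫ g := by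
              rw [h1]
          _ = (pullback.lift r.left r.right r.w ≫ pullback.snd φ.e φ.e) ≫ g := by
              rw [Category.assoc, hc, Category.assoc]
          _ = r.right ≫ g := by rw [h2])
  exact HasColimit.mk ⟨_, col⟩

/-- An object `P` is (regular) projective: it is projective with respect to the class of regular
epimorphisms. -/
def IsRegularProjective (P : C) : Prop :=
  ∀ ⦃X Y : C⦄ (e : X ⟶ Y) (g : P ⟶ Y), IsRegularEpi e → ∃ h : P ⟶ X, h ≫ e = g

/-- A projective presentation of `B`: a regular epimorphism `f : P ⟶ B` with `P` projective. -/
structure IsProjectivePresentation {P B : C} (f : P ⟶ B) : Prop where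
  regularEpi : IsRegularEpi f
  projective : IsRegularProjective P

end Exactness

section Reflections

variable {C : Type u₁} [Category.{v₁} C] {D : Type u₂} [Category.{v₂} D]
variable {L : C ⥤ D} {R : D ⥤ C} (adj : L ⊣ R)

/-- The unit `η_X : X ⟶ R L X` of a reflection. -/
def unitAt (X : C) : X ⟶ R.obj (L.obj X) := adj.unit.app X

theorem unitAt_naturality {X Y : C} (g : X ⟶ Y) :
    unitAt adj X ≫ R.map (L.map g) = g ≫ unitAt adj Y :=
  (adj.unit.naturality g).symm

/-- A full subcategory `R : D ⥤ C` with reflector `L` is regular epi-reflective if every component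
of the unit is a regular epimorphism of `C`. -/
structure IsRegularEpiReflective [R.Full] [R.Faithful] : Prop where
  regularEpi_unit : ∀ X : C, IsRegularEpi (unitAt adj X)

/-- A Birkhoff subcategory: a full regular epi-reflective subcategory which is closed under
regular quotients. -/
structure IsBirkhoff [R.Full] [R.Faithful] : Prop extends IsRegularEpiReflective adj where
  quotient_closed : ∀ ⦃X Y : C⦄ (f : X ⟶ Y), IsRegularEpi f → R.essImage X → R.essImage Y

/-- Admissibility, for the class of regular epimorphisms of `C`: for every object `B` of `C` and
every `φ : X ⟶ L B` in `D` which is a regular epimorphism in `C`, the component at `(X, φ)` of the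
counit of the induced adjunction between extensions of `B` in `C` and extensions of `L B` in `D`,
that is, `L (B ×_{R L B} R X) ⟶ L R X ⟶ X`, is an isomorphism. -/
def IsAdmissible : Prop :=
  ∀ ⦃B : C⦄ ⦃X : D⦄ (φ : X ⟶ L.obj B), IsRegularEpi (R.map φ) →
    ∀ ⦃W : C⦄ (π₁ : W ⟶ B) (π₂ : W ⟶ R.obj X),
      IsPullback π₁ π₂ (unitAt adj B) (R.map φ) →
        IsIso (L.map π₂ ≫ adj.counit.app X)

/-- A functor is protoadditive if it preserves split short exact sequences. -/
def IsProtoadditive [HasZeroMorphisms C] [HasZeroMorphisms D] (F : C ⥤ D) : Prop :=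
  ∀ ⦃K A B : C⦄ (k : K ⟶ A) (f : A ⟶ B) (s : B ⟶ A),
    IsSplitShortExact k f s → IsSplitShortExact (F.map k) (F.map f) (F.map s)

/-- A full reflective subcategory of a finitely complete category is finitely complete. -/
theorem hasFiniteLimits_of_adjunction (adj : L ⊣ R) [R.Full] [R.Faithful] [HasFiniteLimits C] :
    HasFiniteLimits D := by
  let _ : Reflective R := { L := L, adj := adj }
  exact ⟨fun _ _ _ => hasLimitsOfShape_of_reflective R⟩

end Reflections

section Extensions

variable {C : Type u₁} [Category.{v₁} C] [Regular C]

instance : (MorphismProperty.regularEpi C).IsStableUnderBaseChange :=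
  Regular.regularEpiIsStableUnderBaseChange

/-- A monadic extension: a regular epimorphism `p : E ⟶ B` such that the pullback functor `p^*`,
from the full subcategory of `C/B` on the regular epimorphisms to the full subcategory of `C/E` on
the regular epimorphisms, is monadic. -/
structure IsMonadicExtension {E B : C} (p : E ⟶ B) : Prop where
  regularEpi : IsRegularEpi p
  monadic : Nonempty (MonadicRightAdjoint
    (MorphismProperty.Over.pullback (MorphismProperty.regularEpi C) ⊤ p))

variable {D : Type u₂} [Category.{v₂} D] {L : C ⥤ D} {R : D ⥤ C} (adj : L ⊣ R)

/-- A trivial extension: a regular epimorphism whose naturality square for the unit is a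
pullback. -/
structure IsTrivialExtension {E B : C} (f : E ⟶ B) : Prop where
  regularEpi : IsRegularEpi f
  isPullback : IsPullback (unitAt adj E) f (R.map (L.map f)) (unitAt adj B)

/-- A normal extension: a monadic extension `f` such that `f^*(f)`, a projection of the kernel pair
of `f`, is a trivial extension. -/
structure IsNormalExtension {E B : C} (f : E ⟶ B) : Prop where
  monadicExtension : IsMonadicExtension f
  trivial_pullback : IsTrivialExtension adj (pullback.fst f f)

/-- A normal extension of `B` is weakly universal if it factors through every normal extension
of `B`. -/
structure IsWeaklyUniversalNormalExtension {E B : C} (p : E ⟶ B) : Prop where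
  normal : IsNormalExtension adj p
  weaklyUniversal : ∀ ⦃E' : C⦄ (p' : E' ⟶ B), IsNormalExtension adj p' →
    ∃ u : E ⟶ E', u ≫ p' = p

/-- The Galois group `Gal(E, p, 0)`, an object of the subcategory `D`: the kernel of
`⟨L π₁, L π₂⟩ : L (E ×_B E) ⟶ L E × L E`. -/
def galoisGroup [R.Full] [R.Faithful] [HasZeroMorphisms D] {E B : C} (p : E ⟶ B) : D :=
  haveI : HasFiniteLimits D := hasFiniteLimits_of_adjunction adj
  kernel (prod.lift (L.map (pullback.fst p p)) (L.map (pullback.snd p p)))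

end Extensions

section Commutators

variable {C : Type u₁} [Category.{v₁} C] [HasZeroMorphisms C] [Homological C]
variable {D : Type u₂} [Category.{v₂} D] {L : C ⥤ D} {R : D ⥤ C} (adj : L ⊣ R)

/-- The homological closure of a normal subobject `k : K ⟶ A` for the reflection `adj`: the inverse
image along `A ⟶ A/K` of the kernel of the unit `A/K ⟶ R L (A/K)`. -/
def closure {K A : C} (k : K ⟶ A) [IsNormalMono k] : Subobject A :=
  (Subobject.pullback (cokernel.π k)).obj (kernelSubobject (unitAt adj (cokernel k)))

/-- The restriction of a morphism to the kernels of the units at its domain and codomain. -/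
abbrev unitKernelMap {X Y : C} (g : X ⟶ Y) :
    kernel (unitAt adj X) ⟶ kernel (unitAt adj Y) :=
  kernel.map (unitAt adj X) (unitAt adj Y) g (R.map (L.map g)) (unitAt_naturality adj g)

/-- The relative commutator `[K[f], A]` of `f : A ⟶ B`: the kernel of the restriction of the first
projection of the kernel pair of `f` to the kernels of the units. -/
abbrev relativeCommutator {A B : C} (f : A ⟶ B) : C :=
  kernel (unitKernelMap adj (pullback.fst f f))

/-- The relative commutator `[K[f], A]` as a subobject of `A`, through the second projection of the
kernel pair. -/
def relativeCommutator.ι {A B : C} (f : A ⟶ B) : relativeCommutator adj f ⟶ A :=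
  kernel.ι (unitKernelMap adj (pullback.fst f f)) ≫ unitKernelMap adj (pullback.snd f f) ≫
    kernel.ι (unitAt adj A)

theorem unitKernelMap_comp_ι {X Y : C} (g : X ⟶ Y) :
    unitKernelMap adj g ≫ kernel.ι (unitAt adj Y) = kernel.ι (unitAt adj X) ≫ g :=
  kernel.lift_ι _ _ _

theorem relativeCommutator.ι_eq {A B : C} (f : A ⟶ B) :
    relativeCommutator.ι adj f = kernel.ι (unitKernelMap adj (pullback.fst f f)) ≫
      kernel.ι (unitAt adj (pullback f f)) ≫ pullback.snd f f := by
  rw [relativeCommutator.ι, unitKernelMap_comp_ι]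

theorem relativeCommutator.fst_eq_zero {A B : C} (f : A ⟶ B) :
    kernel.ι (unitKernelMap adj (pullback.fst f f)) ≫
      kernel.ι (unitAt adj (pullback f f)) ≫ pullback.fst f f = 0 := by
  rw [← unitKernelMap_comp_ι, ← Category.assoc, kernel.condition, zero_comp]

theorem relativeCommutator.ι_comp {A B : C} (f : A ⟶ B) :
    relativeCommutator.ι adj f ≫ f = 0 := by
  have h := congrArg (· ≫ f) (relativeCommutator.fst_eq_zero adj f)
  simp only [Category.assoc, zero_comp] at h
  rw [relativeCommutator.ι_eq, Category.assoc, Category.assoc, ← pullback.condition, h]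

/-- The relative commutator `[K[f], A]` as a subobject of `K[f]`. -/
def relativeCommutator.toKernel {A B : C} (f : A ⟶ B) : relativeCommutator adj f ⟶ kernel f :=
  kernel.lift f (relativeCommutator.ι adj f) (relativeCommutator.ι_comp adj f)

/-- `[K[f], A]` is the kernel of `K[f] ⟶ A ×_B A ⟶ R L (A ×_B A)`; in particular it is normal
in `K[f]`. -/
instance relativeCommutator.isNormalMono_toKernel {A B : C} (f : A ⟶ B) :
    IsNormalMono (relativeCommutator.toKernel adj f) := by
  let j : kernel f ⟶ pullback f f := pullback.lift 0 (kernel.ι f) (by simp)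
  have hj₁ : j ≫ pullback.fst f f = 0 := pullback.lift_fst _ _ _
  have hj₂ : j ≫ pullback.snd f f = kernel.ι f := pullback.lift_snd _ _ _
  have hcomp : relativeCommutator.toKernel adj f ≫ j =
      kernel.ι (unitKernelMap adj (pullback.fst f f)) ≫
        kernel.ι (unitAt adj (pullback f f)) := by
    apply pullback.hom_ext
    · rw [Category.assoc, hj₁, comp_zero, Category.assoc, relativeCommutator.fst_eq_zero]
    · rw [Category.assoc, hj₂, Category.assoc, ← relativeCommutator.ι_eq]
      exact kernel.lift_ι _ _ _
  have hw : relativeCommutator.toKernel adj f ≫ (j ≫ unitAt adj (pullback f f)) = 0 := by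
    rw [← Category.assoc, hcomp, Category.assoc, kernel.condition, comp_zero]
  have hm : Mono (relativeCommutator.toKernel adj f) := by
    have : Mono (relativeCommutator.toKernel adj f ≫ j) := by
      rw [hcomp]; exact mono_comp _ _
    exact mono_of_mono _ j
  have hmj : Mono j := by
    have : Mono (j ≫ pullback.snd f f) := by rw [hj₂]; infer_instance
    exact mono_of_mono j (pullback.snd f f)
  refine ⟨⟨{ Z := _, g := j ≫ unitAt adj (pullback f f), w := hw, isLimit := ?_ }⟩⟩
  refine KernelFork.IsLimit.ofι' _ hw fun {T} t ht => ?_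
  have h₁ : (t ≫ j) ≫ unitAt adj (pullback f f) = 0 := by rw [Category.assoc]; exact ht
  refine ⟨kernel.lift _ (kernel.lift _ (t ≫ j) h₁) ?_, ?_⟩
  · rw [← cancel_mono (kernel.ι (unitAt adj A))]
    rw [Category.assoc, unitKernelMap_comp_ι, kernel.lift_ι_assoc, Category.assoc, hj₁, comp_zero,
      zero_comp]
  · rw [← cancel_mono j, Category.assoc, hcomp]
    rw [kernel.lift_ι_assoc, kernel.lift_ι]

open ZeroObject in
/-- The relative commutator `[A, A]`, obtained from `A ⟶ 0`, as a subobject of `A`. -/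
def selfCommutator.ι (A : C) : relativeCommutator adj (0 : A ⟶ (0 : C)) ⟶ A :=
  relativeCommutator.ι adj (0 : A ⟶ (0 : C))

open ZeroObject in
instance selfCommutator.isNormalMono (A : C) : IsNormalMono (selfCommutator.ι adj A) := by
  obtain ⟨N⟩ := (relativeCommutator.isNormalMono_toKernel adj (0 : A ⟶ (0 : C))).normalMono
  have hfac : relativeCommutator.toKernel adj (0 : A ⟶ (0 : C)) ≫ kernel.ι (0 : A ⟶ (0 : C)) =
      selfCommutator.ι adj A := kernel.lift_ι _ _ _
  have hm : Mono (relativeCommutator.toKernel adj (0 : A ⟶ (0 : C))) :=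
    mono_of_isLimit_fork N.isLimit
  have hm' : Mono (selfCommutator.ι adj A) := by rw [← hfac]; exact mono_comp _ _
  have hw : selfCommutator.ι adj A ≫ (inv (kernel.ι (0 : A ⟶ (0 : C))) ≫ N.g) = 0 := by
    rw [← hfac, Category.assoc, IsIso.hom_inv_id_assoc, N.w]
  refine ⟨⟨{ Z := N.Z, g := inv (kernel.ι (0 : A ⟶ (0 : C))) ≫ N.g, w := hw, isLimit := ?_ }⟩⟩
  refine KernelFork.IsLimit.ofι' _ hw fun {T} t ht => ?_
  obtain ⟨l, hl⟩ := KernelFork.IsLimit.lift' N.isLimit (t ≫ inv (kernel.ι (0 : A ⟶ (0 : C))))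
    (by rw [Category.assoc]; exact ht)
  refine ⟨l, ?_⟩
  have hl' : l ≫ relativeCommutator.toKernel adj (0 : A ⟶ (0 : C)) =
      t ≫ inv (kernel.ι (0 : A ⟶ (0 : C))) := hl
  rw [← hfac, ← Category.assoc, hl', Category.assoc, IsIso.inv_hom_id, Category.comp_id]

end Commutators

section HopfFormula

variable {A : Type u₁} [Category.{v₁} A] [HasZeroMorphisms A] [Homological A]
variable {ℬ : Type u₂} [Category.{v₂} ℬ] {I : A ⥤ ℬ} {H : ℬ ⥤ A} (adjB : I ⊣ H)
variable {ℱ : Type*} [Category* ℱ] {F' : A ⥤ ℱ} {U' : ℱ ⥤ A} (adjF : F' ⊣ U')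

/-- The numerator `K[f] ∧ cl_P [P, P]`, a subobject of `P`; the commutator is relative to `adjB`
and the closure is relative to `adjF`. -/
def hopfNumerator {P B : A} (f : P ⟶ B) : Subobject P :=
  kernelSubobject f ⊓ closure adjF (selfCommutator.ι adjB P)

/-- The denominator `cl_{K[f]} [K[f], P]`, a subobject of `K[f]` regarded as a subobject of `P`
through the inclusion of `K[f]`; the commutator is relative to `adjB` and the closure is relative
to `adjF`. -/
def hopfDenominator {P B : A} (f : P ⟶ B) : Subobject P :=
  (Subobject.map (kernel.ι f)).obj (closure adjF (relativeCommutator.toKernel adjB f))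

end HopfFormula

end

end SemiAbelianHopf

/-!
Let `η¹` and `η` be the units of `I ⊣ H` and of the composite reflection. Protoadditivity of `F`
identifies the homological closure of `[K[f], P]_ℬ` in `K[f]` with the relative commutator of `f`
for the composite reflection. Dividing it out of `P` gives the centralization `c : E ⟶ B` of `f`.
On `K[η¹]` of the kernel pair of `c` the two projections agree, so `K[η¹]` meets the kernel of the
first projection trivially; as `K[c]` is in `ℱ`, protoadditivity upgrades this from `η¹` to `η`,
and `c` is a normal extension. It is weakly universal because `P` is projective. The Galois group
of a normal extension `p : E ⟶ B` is `K[p] ∧ K[η_E]`, and for `c` the inverse image of this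
subobject under `P ⟶ E` is `K[f] ∧ K[η_P]`, the numerator of the Hopf formula, so the formula is
Noether's isomorphism theorem.
-/

namespace SemiAbelianHopf

noncomputable section

attribute [local simp] pullback.lift_fst pullback.lift_fst_assoc pullback.lift_snd
  pullback.lift_snd_assoc prod.lift_fst prod.lift_fst_assoc prod.lift_snd prod.lift_snd_assoc

section Kernels

variable {C : Type u₁} [Category.{v₁} C] [HasZeroMorphisms C]

/-- The morphism `k` is a kernel of `f`; the universal property is only asserted to hold, so that
this is a proposition. -/
structure IsKernel {K A B : C} (k : K ⟶ A) (f : A ⟶ B) : Prop where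
  w : k ≫ f = 0
  isLimit : Nonempty (IsLimit (KernelFork.ofι k w))

theorem isKernel_kernel_ι {A B : C} (f : A ⟶ B) [HasKernel f] : IsKernel (kernel.ι f) f :=
  ⟨kernel.condition f, ⟨kernelIsKernel f⟩⟩

namespace IsKernel

variable {K A B : C} {k : K ⟶ A} {f : A ⟶ B}

theorem mono (h : IsKernel k f) : Mono k := mono_of_isLimit_fork h.isLimit.some

theorem exists_lift (h : IsKernel k f) {T : C} (t : T ⟶ A) (ht : t ≫ f = 0) :
    ∃ l : T ⟶ K, l ≫ k = t :=
  ⟨_, (KernelFork.IsLimit.lift' h.isLimit.some t ht).2⟩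

theorem of_exists_lift [Mono k] (w : k ≫ f = 0)
    (h : ∀ ⦃T : C⦄ (t : T ⟶ A), t ≫ f = 0 → ∃ l : T ⟶ K, l ≫ k = t) : IsKernel k f :=
  ⟨w, ⟨KernelFork.IsLimit.ofι' k w fun t ht => ⟨(h t ht).choose, (h t ht).choose_spec⟩⟩⟩

theorem of_comp_eq_zero_iff (h : IsKernel k f) {Z : C} {g : A ⟶ Z}
    (hfg : ∀ ⦃T : C⦄ (t : T ⟶ A), t ≫ f = 0 ↔ t ≫ g = 0) : IsKernel k g :=
  have := h.mono
  .of_exists_lift ((hfg k).1 h.w) fun _ t ht => h.exists_lift t ((hfg t).2 ht)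

theorem isNormalMono (h : IsKernel k f) : IsNormalMono k :=
  ⟨⟨⟨_, f, h.w, h.isLimit.some⟩⟩⟩

theorem map (h : IsKernel k f) {D : Type u₂} [Category.{v₂} D] [HasZeroMorphisms D] (G : C ⥤ D)
    [G.PreservesZeroMorphisms] [PreservesLimit (parallelPair f 0) G] :
    IsKernel (G.map k) (G.map f) :=
  ⟨by rw [← G.map_comp, h.w, G.map_zero], ⟨KernelFork.mapIsLimit _ h.isLimit.some G⟩⟩

theorem arrow_mk [Mono k] (h : IsKernel k f) : IsKernel (Subobject.mk k).arrow f :=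
  .of_exists_lift (by rw [← Subobject.underlyingIso_hom_comp_eq_mk, Category.assoc, h.w, comp_zero])
    fun _ t ht => by
      obtain ⟨l, rfl⟩ := h.exists_lift t ht
      exact ⟨l ≫ (Subobject.underlyingIso k).inv, by simp⟩

theorem isPullback_of_comp {A B D M N : C} {q : A ⟶ B} {h : B ⟶ D} {m : M ⟶ A} {n : N ⟶ B}
    (hm : IsKernel m (q ≫ h)) (hn : IsKernel n h) {r : M ⟶ N} (hr : r ≫ n = m ≫ q) :
    IsPullback m r q n := by
  have := hm.mono
  have := hn.mono
  have hlift (s : PullbackCone q n) : ∃ l, l ≫ m = s.fst :=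
    hm.exists_lift s.fst (by rw [s.condition_assoc, hn.w, comp_zero])
  choose l hl using hlift
  refine .of_isLimit' ⟨hr.symm⟩ (PullbackCone.IsLimit.mk _ l hl (fun s => ?_) fun s t ht _ => ?_)
  · rw [← cancel_mono n, Category.assoc, hr, reassoc_of% hl, s.condition]
  · rw [← cancel_mono m, ht, hl]

end IsKernel

theorem isKernel_kernelSubobject_arrow {A B : C} (f : A ⟶ B) [HasKernel f] :
    IsKernel (kernelSubobject f).arrow f :=
  (isKernel_kernel_ι f).arrow_mk

theorem comp_prod_lift_eq_zero_iff {T X Y Z : C} [HasBinaryProduct Y Z] (t : T ⟶ X) (f : X ⟶ Y)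
    (g : X ⟶ Z) : t ≫ prod.lift f g = 0 ↔ t ≫ f = 0 ∧ t ≫ g = 0 := by
  simp [Limits.prod.hom_ext_iff]

theorem IsKernel.pullback_lift {K P E B : C} {k : K ⟶ E} {p : E ⟶ B} (hk : IsKernel k p)
    (f : P ⟶ B) [HasPullback f p] :
    IsKernel (pullback.lift 0 k (by rw [zero_comp, hk.w])) (pullback.fst f p) := by
  have := hk.mono
  have : Mono (pullback.lift 0 k (by rw [zero_comp, hk.w]) : K ⟶ pullback f p) :=
    mono_of_mono_fac (pullback.lift_snd _ _ _)
  refine .of_exists_lift (pullback.lift_fst _ _ _) fun T t ht => ?_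
  obtain ⟨l, hl⟩ := hk.exists_lift (t ≫ pullback.snd f p) (by
    rw [Category.assoc, ← pullback.condition, reassoc_of% ht, zero_comp])
  exact ⟨l, pullback.hom_ext (by simp [ht]) (by simp [hl])⟩

variable [HasKernels C] [HasPullbacks C]

/-- The kernel of `p`, included in the pullback of `p` along `f` as the kernel of the projection
`pullback.fst f p`. -/
def kernelToPullback {P E B : C} (f : P ⟶ B) (p : E ⟶ B) : kernel p ⟶ pullback f p :=
  pullback.lift 0 (kernel.ι p) (by simp)

@[simp]
theorem kernelToPullback_fst {P E B : C} (f : P ⟶ B) (p : E ⟶ B) :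
    kernelToPullback f p ≫ pullback.fst f p = 0 :=
  pullback.lift_fst _ _ _

@[simp]
theorem kernelToPullback_snd {P E B : C} (f : P ⟶ B) (p : E ⟶ B) :
    kernelToPullback f p ≫ pullback.snd f p = kernel.ι p :=
  pullback.lift_snd _ _ _

instance {P E B : C} (f : P ⟶ B) (p : E ⟶ B) : Mono (kernelToPullback f p) :=
  mono_of_mono_fac (kernelToPullback_snd f p)

theorem isKernel_kernelToPullback {P E B : C} (f : P ⟶ B) (p : E ⟶ B) :
    IsKernel (kernelToPullback f p) (pullback.fst f p) :=
  (isKernel_kernel_ι p).pullback_lift f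

end Kernels

section RegularEpi

variable {C : Type u₁} [Category.{v₁} C]

theorem exists_desc_of_isRegularEpi {A B Z : C} (f : A ⟶ B) [IsRegularEpi f] [HasPullback f f]
    (g : A ⟶ Z) (hg : pullback.fst f f ≫ g = pullback.snd f f ≫ g) : ∃ l : B ⟶ Z, f ≫ l = g :=
  ⟨IsRegularEpi.desc f g (by simpa using pullback.lift _ _ (IsRegularEpi.w f) ≫= hg),
    IsRegularEpi.fac f g _⟩

variable [Regular C]

theorem isRegularEpi_of_isRegularEpi_comp {X Y Z : C} (f : X ⟶ Y) (g : Y ⟶ Z)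
    [IsRegularEpi (f ≫ g)] : IsRegularEpi g :=
  have := strongEpi_of_strongEpi f g
  inferInstance

theorem isRegularEpi_of_isPullback {W X Y Z : C} {f : W ⟶ X} {g : W ⟶ Y} {h : X ⟶ Z} {i : Y ⟶ Z}
    (sq : IsPullback f g h i) [hi : IsRegularEpi i] : IsRegularEpi f :=
  Regular.regularEpiIsStableUnderBaseChange.of_isPullback sq.flip hi

theorem IsKernel.isRegularEpi_of_comp [HasZeroMorphisms C] {A B D M N : C} {q : A ⟶ B}
    [IsRegularEpi q] {h : B ⟶ D} {m : M ⟶ A} {n : N ⟶ B} (hm : IsKernel m (q ≫ h))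
    (hn : IsKernel n h) {r : M ⟶ N} (hr : r ≫ n = m ≫ q) : IsRegularEpi r :=
  isRegularEpi_of_isPullback (hm.isPullback_of_comp hn hr).flip

end RegularEpi

section Homological

variable {C : Type u₁} [Category.{v₁} C] [HasZeroMorphisms C] [Homological C]

theorem isIso_of_kernel_factors_of_section {K M W S : C} (m : M ⟶ W) [Mono m] {b : W ⟶ S}
    {k : K ⟶ W} (hk : IsKernel k b) (s : S ⟶ M) (hs : s ≫ m ≫ b = 𝟙 S) (l : K ⟶ M)
    (hl : l ≫ m = k) : IsIso m := by
  have := hk.mono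
  have : Mono l := mono_of_mono_fac hl
  have hl' : IsKernel l (m ≫ b) :=
    .of_exists_lift (by rw [reassoc_of% hl, hk.w]) fun _ t ht => by
      obtain ⟨r, hr⟩ := hk.exists_lift (t ≫ m) (by rwa [Category.assoc])
      exact ⟨r, by rw [← cancel_mono m, Category.assoc, hl, hr]⟩
  exact Homological.splitShortFive l (m ≫ b) s k b (s ≫ m) (𝟙 K) m (𝟙 S) hl'.w hk.w hl'.isLimit
    hk.isLimit hs (by rwa [Category.assoc]) (by simpa using hl) (by simp) (by simp)
    inferInstance inferInstance

theorem isIso_of_kernel_factors {K M W S : C} (m : M ⟶ W) [Mono m] {b : W ⟶ S}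
    [IsRegularEpi (m ≫ b)] {k : K ⟶ W} (hk : IsKernel k b) (l : K ⟶ M) (hl : l ≫ m = k) :
    IsIso m := by
  -- pulling back along `m ≫ b` reduces this to the case where `m ≫ b` has a section
  let v : pullback (m ≫ b) (m ≫ b) ⟶ pullback (m ≫ b) b :=
    pullback.lift (pullback.fst _ _) (pullback.snd _ _ ≫ m) (by simp [pullback.condition])
  have : Mono v := ⟨fun x y h => pullback.hom_ext
    (by simpa [v] using h =≫ pullback.fst _ _)
    (by simpa [v, ← cancel_mono m] using h =≫ pullback.snd _ _)⟩
  obtain ⟨r, hr⟩ := hk.exists_lift (kernel.ι b) (kernel.condition b)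
  have hrlb : (r ≫ l) ≫ m ≫ b = 0 := by rw [Category.assoc, reassoc_of% hl, hk.w, comp_zero]
  have : IsIso v := isIso_of_kernel_factors_of_section v (isKernel_kernelToPullback (m ≫ b) b)
    (pullback.diagonal (m ≫ b)) (by simp [v]) (pullback.lift 0 (r ≫ l) (by rw [hrlb, zero_comp]))
    (pullback.hom_ext (by simp [v]) (by simp [v, hl, hr]))
  have : IsRegularEpi (pullback.snd (m ≫ b) (m ≫ b) ≫ m) := by
    rw [← pullback.lift_snd (f := m ≫ b) (g := b) (pullback.fst _ _) (pullback.snd _ _ ≫ m)]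
    change IsRegularEpi (v ≫ _)
    infer_instance
  have := isRegularEpi_of_isRegularEpi_comp (pullback.snd (m ≫ b) (m ≫ b)) m
  exact isIso_of_mono_of_strongEpi m

theorem isRegularEpi_of_kernel_factors {K X W S : C} (v : X ⟶ W) {b : W ⟶ S}
    [IsRegularEpi (v ≫ b)] {k : K ⟶ W} (hk : IsKernel k b) (t : K ⟶ X) (ht : t ≫ v = k) :
    IsRegularEpi v := by
  let φ := Regular.strongEpiMonoFactorisation v
  have : IsRegularEpi (φ.e ≫ φ.m ≫ b) := by rwa [← Category.assoc, φ.fac]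
  have := isRegularEpi_of_isRegularEpi_comp φ.e (φ.m ≫ b)
  have := isIso_of_kernel_factors φ.m hk (t ≫ φ.e) (by rw [Category.assoc, φ.fac, ht])
  rw [← φ.fac]
  infer_instance

theorem mono_of_cancel_zero {X Y : C} (g : X ⟶ Y)
    (h : ∀ ⦃T : C⦄ (t : T ⟶ X), t ≫ g = 0 → t = 0) : Mono g := by
  have := isIso_of_kernel_factors_of_section (pullback.diagonal g) (isKernel_kernelToPullback g g)
    (𝟙 X) (by simp) 0
    (pullback.hom_ext (by simp) (by simp [h _ (kernel.condition g)]))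
  exact pullback.isIso_diagonal_iff g |>.1 this

theorem eq_of_kernel_of_section {K A B Z : C} {a : A ⟶ B} {k : K ⟶ A} (hk : IsKernel k a)
    (s : B ⟶ A) (hs : s ≫ a = 𝟙 B) {g h : A ⟶ Z} (hkgh : k ≫ g = k ≫ h)
    (hsgh : s ≫ g = s ≫ h) : g = h := by
  have := isIso_of_kernel_factors_of_section (equalizer.ι g h) hk (equalizer.lift s hsgh)
    (by simp [hs]) (equalizer.lift k hkgh) (by simp)
  exact eq_of_epi_equalizer

namespace IsKernel

theorem exists_desc {K A B Z : C} {k : K ⟶ A} {f : A ⟶ B} [IsRegularEpi f] (hk : IsKernel k f)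
    (g : A ⟶ Z) (hg : k ≫ g = 0) : ∃ l : B ⟶ Z, f ≫ l = g :=
  exists_desc_of_isRegularEpi f g (regularEpi_desc_condition f k hk.w hk.isLimit.some g hg)

theorem nonempty_iso_cokernel {K A B : C} {k : K ⟶ A} {f : A ⟶ B} [IsRegularEpi f]
    (hk : IsKernel k f) [HasCokernel k] : Nonempty (B ≅ cokernel k) := by
  obtain ⟨l, hl⟩ := hk.exists_desc (cokernel.π k) (cokernel.condition k)
  exact ⟨⟨l, cokernel.desc k f hk.w, by simp [← cancel_epi f, reassoc_of% hl],
    by simp [← cancel_epi (cokernel.π k), hl]⟩⟩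

end IsKernel

theorem isKernel_cokernel_π {K A : C} (k : K ⟶ A) [h : IsNormalMono k] :
    IsKernel k (cokernel.π k) := by
  obtain ⟨N⟩ := h.normalMono
  have := mono_of_isLimit_fork N.isLimit
  refine .of_exists_lift (cokernel.condition k) fun _ t ht =>
    ⟨_, (KernelFork.IsLimit.lift' N.isLimit t ?_).2⟩
  rw [← cokernel.π_desc k N.g N.w, reassoc_of% ht, zero_comp]

theorem exists_mono_fac_of_comp_eq_zero_iff {A B Z : C} (q : A ⟶ B) [IsRegularEpi q] (w : A ⟶ Z)
    (h : ∀ ⦃T : C⦄ (t : T ⟶ A), t ≫ q = 0 ↔ t ≫ w = 0) : ∃ m : B ⟶ Z, Mono m ∧ q ≫ m = w := by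
  obtain ⟨m, rfl⟩ := (isKernel_kernel_ι q).exists_desc w ((h _).1 (kernel.condition q))
  refine ⟨m, mono_of_cancel_zero m fun T t ht => ?_, rfl⟩
  have hq : pullback.snd t q ≫ q = 0 := (h _).2 (by
    rw [← pullback.condition_assoc, ht, comp_zero])
  rw [← cancel_epi (pullback.fst t q), pullback.condition, hq, comp_zero]

/-- Noether's isomorphism theorem: `T / S` is the image of `T` in the quotient by `S`. -/
theorem nonempty_iso_cokernel_ofLE {A B D N : C} {S T : Subobject A} {q : A ⟶ B} [IsRegularEpi q]
    {h : B ⟶ D} {n : N ⟶ B} (hS : IsKernel S.arrow q) (hT : IsKernel T.arrow (q ≫ h))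
    (hn : IsKernel n h) (hle : S ≤ T) :
    ∃ _ : IsNormalMono (S.ofLE T hle), Nonempty (N ≅ cokernel (S.ofLE T hle)) := by
  have := hn.mono
  obtain ⟨r, hr⟩ := hn.exists_lift (T.arrow ≫ q) (by rw [Category.assoc, hT.w])
  have := hT.isRegularEpi_of_comp hn hr
  have hker : IsKernel (S.ofLE T hle) r := by
    refine .of_exists_lift ?_ fun _ t ht => ?_
    · rw [← cancel_mono n, Category.assoc, hr, Subobject.ofLE_arrow_assoc, hS.w, zero_comp]
    · obtain ⟨l, hl⟩ := hS.exists_lift (t ≫ T.arrow)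
        (by rw [Category.assoc, ← hr, reassoc_of% ht, zero_comp])
      exact ⟨l, by rw [← cancel_mono T.arrow, Category.assoc, Subobject.ofLE_arrow, hl]⟩
  exact ⟨hker.isNormalMono, have := hker.isNormalMono; hker.nonempty_iso_cokernel⟩

section SplitSquare

variable {R X R' X' : C} {r : R ⟶ X} {σ : X ⟶ R} {r' : R' ⟶ X'} {σ' : X' ⟶ R'} {ρ : R ⟶ R'}
  {g : X ⟶ X'} [IsRegularEpi ρ]

theorem isRegularEpi_pullback_lift_of_section (hσ : σ ≫ r = 𝟙 X) (hr : r ≫ g = ρ ≫ r')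
    (hσρ : σ ≫ ρ = g ≫ σ') : IsRegularEpi (pullback.lift r ρ hr) := by
  have : IsRegularEpi (pullback.lift r ρ hr ≫ pullback.snd g r') := by rwa [pullback.lift_snd]
  have hk := isKernel_kernel_ι (pullback.snd g r')
  have hkg : kernel.ι (pullback.snd g r') ≫ pullback.fst g r' ≫ g = 0 := by
    rw [pullback.condition, reassoc_of% hk.w, zero_comp]
  refine isRegularEpi_of_kernel_factors _ hk (kernel.ι _ ≫ pullback.fst g r' ≫ σ)
    (pullback.hom_ext (by simp [hσ]) ?_)
  simp only [Category.assoc, pullback.lift_snd]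
  rw [hσρ, reassoc_of% hkg, zero_comp, hk.w]

theorem IsKernel.isRegularEpi_of_section {K K' : C} {k : K ⟶ R} (hk : IsKernel k r) {k' : K' ⟶ R'}
    (hk' : IsKernel k' r') {u : K ⟶ K'} (hu : u ≫ k' = k ≫ ρ) (hσ : σ ≫ r = 𝟙 X)
    (hr : r ≫ g = ρ ≫ r') (hσρ : σ ≫ ρ = g ≫ σ') : IsRegularEpi u := by
  have := isRegularEpi_pullback_lift_of_section hσ hr hσρ
  have hkr : IsKernel k (pullback.lift r ρ hr ≫ pullback.fst g r') := by rwa [pullback.lift_fst]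
  exact hkr.isRegularEpi_of_comp (hk'.pullback_lift g)
    (pullback.hom_ext (by simp [hk.w]) (by simp [hu]))

end SplitSquare

end Homological

section Malcev

variable {C : Type u₁} [Category.{v₁} C] [HasZeroMorphisms C] [Homological C]

theorem exists_euclidean_of_reflexive {R X : C} (r₁ r₂ : R ⟶ X) [hj : JointlyMono₂ r₁ r₂]
    (s : X ⟶ R) (hs₁ : s ≫ r₁ = 𝟙 X) (hs₂ : s ≫ r₂ = 𝟙 X) :
    ∃ τ : pullback r₁ r₁ ⟶ R,
      τ ≫ r₁ = pullback.fst r₁ r₁ ≫ r₂ ∧ τ ≫ r₂ = pullback.snd r₁ r₁ ≫ r₂ := by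
  let ρ : R ⟶ X ⨯ X := prod.lift r₁ r₂
  have : Mono ρ := ⟨fun x y hxy => hj.right_cancellation _ _
    (by simpa [ρ] using hxy =≫ prod.fst) (by simpa [ρ] using hxy =≫ prod.snd)⟩
  let σ : pullback r₁ r₁ ⟶ X ⨯ X :=
    prod.lift (pullback.fst r₁ r₁ ≫ r₂) (pullback.snd r₁ r₁ ≫ r₂)
  -- `σ` factors through `ρ` since the pairs that do so contain the diagonal and the kernel of the
  -- first projection
  have := isIso_of_kernel_factors_of_section (pullback.fst σ ρ) (isKernel_kernelToPullback r₁ r₁)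
    (pullback.lift (pullback.diagonal r₁) (r₂ ≫ s)
      (Limits.prod.hom_ext (by simp [σ, ρ, hs₁]) (by simp [σ, ρ, hs₂]))) (by simp)
    (pullback.lift (kernelToPullback r₁ r₁) (kernel.ι r₁)
      (Limits.prod.hom_ext (by simp [σ, ρ, reassoc_of% kernelToPullback_fst])
        (by simp [σ, ρ, reassoc_of% kernelToPullback_snd]))) (by simp)
  have hτ : (inv (pullback.fst σ ρ) ≫ pullback.snd σ ρ) ≫ ρ = σ := by
    rw [Category.assoc, ← pullback.condition, IsIso.inv_hom_id_assoc]
  refine ⟨inv (pullback.fst σ ρ) ≫ pullback.snd σ ρ, ?_, ?_⟩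
  · simpa only [σ, ρ, Category.assoc, prod.lift_fst] using hτ =≫ prod.fst
  · simpa only [σ, ρ, Category.assoc, prod.lift_snd] using hτ =≫ prod.snd

theorem isEquivalenceRelation_of_reflexive {R X : C} (r₁ r₂ : R ⟶ X) [hj : JointlyMono₂ r₁ r₂]
    (s : X ⟶ R) (hs₁ : s ≫ r₁ = 𝟙 X) (hs₂ : s ≫ r₂ = 𝟙 X) : IsEquivalenceRelation r₁ r₂ := by
  obtain ⟨τ, hτ₁, hτ₂⟩ := exists_euclidean_of_reflexive r₁ r₂ s hs₁ hs₂
  let σ : R ⟶ R := pullback.lift (𝟙 R) (r₁ ≫ s) (by simp [hs₁]) ≫ τ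
  have hσ₁ : σ ≫ r₁ = r₂ := by simp [σ, hτ₁]
  have hσ₂ : σ ≫ r₂ = r₁ := by simp [σ, hτ₂, hs₂]
  exact ⟨⟨{ right_cancellation := hj.right_cancellation
            r := s, reflexivity₁ := hs₁, reflexivity₂ := hs₂
            s := σ, symmetry₁ := hσ₁, symmetry₂ := hσ₂
            c := _, isLimit := pullback.isLimit r₂ r₁
            t := pullback.lift (pullback.fst r₂ r₁ ≫ σ) (pullback.snd r₂ r₁)
              (by rw [Category.assoc, hσ₁, pullback.condition]) ≫ τ
            transitivity₁ := by simp [hτ₁, hσ₂]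
            transitivity₂ := by simp [hτ₂] }⟩⟩

end Malcev

section ExactForks

/-- A Barr-exact homological category: every equivalence relation is a kernel pair. -/
class ExactHomological (C : Type u₁) [Category.{v₁} C] [HasZeroMorphisms C] : Prop
    extends Homological C where
  effective : ∀ ⦃R X : C⦄ (p₁ p₂ : R ⟶ X),
    IsEquivalenceRelation p₁ p₂ → IsEffectiveEquivalenceRelation p₁ p₂

theorem exactHomological_of_semiAbelian (C : Type u₁) [Category.{v₁} C] [HasZeroMorphisms C]
    [SemiAbelian C] : ExactHomological C where
  effective := SemiAbelian.effective

variable {C : Type u₁} [Category.{v₁} C]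

/-- An exact fork `f, g : X ⇉ Y ⟶ Q`: a regular epimorphism `q` coequalizing `f` and `g`, such that
`X` covers the kernel pair of `q`. The projections of the kernel pair of `q` are the basic example;
unlike these, exact forks need not be jointly monic. -/
structure IsExactFork [HasPullbacks C] {X Y Q : C} (f g : X ⟶ Y) (q : Y ⟶ Q) : Prop where
  w : f ≫ q = g ≫ q
  isRegularEpi : IsRegularEpi q
  isRegularEpi_lift : IsRegularEpi (pullback.lift f g w)

namespace IsExactFork

theorem exists_desc [HasPullbacks C] {X Y Q Z : C} {f g : X ⟶ Y} {q : Y ⟶ Q}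
    (h : IsExactFork f g q) (k : Y ⟶ Z) (hk : f ≫ k = g ≫ k) : ∃ u : Q ⟶ Z, q ≫ u = k := by
  have := h.isRegularEpi
  have := h.isRegularEpi_lift
  exact exists_desc_of_isRegularEpi q k (by simpa [← cancel_epi (pullback.lift f g h.w)])

theorem of_isPullback [Regular C] {X Y Q X' Y' Q' : C} {f g : X ⟶ Y} {q : Y ⟶ Q}
    {f' g' : X' ⟶ Y'} {q' : Y' ⟶ Q'} {x : X' ⟶ X} {y : Y' ⟶ Y} {z : Q' ⟶ Q}
    (h : IsExactFork f g q) (hf : IsPullback x f' f y) (hg : g' ≫ y = x ≫ g)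
    (hq : IsPullback y q' q z) (w : f' ≫ q' = g' ≫ q') : IsExactFork f' g' q' := by
  have := h.isRegularEpi
  have := h.isRegularEpi_lift
  let θ : pullback q' q' ⟶ pullback q q := pullback.map q' q' q q y y z hq.w.symm hq.w.symm
  have hθ : IsPullback θ (pullback.fst q' q') (pullback.fst q q) y := by
    refine .of_right ?_ (by simp [θ]) (IsPullback.of_hasPullback q q).flip
    rw [show θ ≫ pullback.snd q q = pullback.snd q' q' ≫ y by simp [θ], hq.w]
    exact (IsPullback.of_hasPullback q' q').flip.paste_horiz hq
  have hlift : IsPullback x (pullback.lift f' g' w) (pullback.lift f g h.w) θ :=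
    .of_bot (by simpa using hf) (pullback.hom_ext (by simp [θ, hf.w]) (by simp [θ, hg])) hθ
  exact ⟨w, isRegularEpi_of_isPullback hq.flip, isRegularEpi_of_isPullback hlift.flip⟩

end IsExactFork

variable [HasZeroMorphisms C] [ExactHomological C]

theorem exists_isExactFork {X Y Z : C} (f g : X ⟶ Y) (s : Z ⟶ X) (c : Z ⟶ Y) [IsRegularEpi c]
    (hf : s ≫ f = c) (hg : s ≫ g = c) : ∃ (Q : C) (q : Y ⟶ Q), IsExactFork f g q := by
  let φ := Regular.strongEpiMonoFactorisation (prod.lift f g)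
  have hφ₁ : φ.e ≫ φ.m ≫ prod.fst = f := by rw [φ.fac_assoc, prod.lift_fst]
  have hφ₂ : φ.e ≫ φ.m ≫ prod.snd = g := by rw [φ.fac_assoc, prod.lift_snd]
  have : JointlyMono₂ (φ.m ≫ prod.fst) (φ.m ≫ prod.snd) := ⟨fun _ a b h₁ h₂ => by
    rw [← cancel_mono φ.m]
    exact Limits.prod.hom_ext (by simpa using h₁) (by simpa using h₂)⟩
  have sq : CommSq (s ≫ φ.e) c φ.m (diag Y) :=
    ⟨Limits.prod.hom_ext (by simp [hf]) (by simp [hg])⟩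
  obtain ⟨E⟩ := (ExactHomological.effective _ _ (isEquivalenceRelation_of_reflexive
    (φ.m ≫ prod.fst) (φ.m ≫ prod.snd) sq.lift (by simp [reassoc_of% sq.fac_right])
    (by simp [reassoc_of% sq.fac_right]))).nonempty_effectiveEquivalenceRelation
  have hE := E.isKernelPair
  have w : f ≫ E.π = g ≫ E.π := by simpa [reassoc_of% hφ₁, reassoc_of% hφ₂] using φ.e ≫= hE.w
  have hlift : pullback.lift f g w = φ.e ≫ hE.isoPullback.hom :=
    pullback.hom_ext (by simp [hφ₁]) (by simp [hφ₂])
  exact ⟨E.B, E.π, w, inferInstance, by rw [hlift]; infer_instance⟩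

theorem isNormalMono_of_image {N M X Y : C} (k : N ⟶ X) [IsNormalMono k] (g : X ⟶ Y)
    [IsRegularEpi g] (e : N ⟶ M) [IsRegularEpi e] (m : M ⟶ Y) [Mono m] (hem : e ≫ m = k ≫ g) :
    IsNormalMono m := by
  let h := cokernel.π k
  have hk : IsKernel k h := isKernel_cokernel_π k
  obtain ⟨Q, q, hq⟩ := exists_isExactFork (pullback.fst h h ≫ g) (pullback.snd h h ≫ g)
    (pullback.diagonal h) g (by simp) (by simp)
  have := hq.isRegularEpi_lift
  let ρ : pullback h h ⟶ pullback q q := pullback.lift _ _ hq.w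
  let j : N ⟶ pullback h h := pullback.lift 0 k (by rw [hk.w, zero_comp])
  have hjρ : j ≫ ρ ≫ pullback.fst q q = 0 := by simp [j, ρ]
  let u : N ⟶ kernel (pullback.fst q q) := kernel.lift _ (j ≫ ρ) (by rwa [Category.assoc])
  have hu : IsRegularEpi u := (hk.pullback_lift h).isRegularEpi_of_section
    (isKernel_kernel_ι (pullback.fst q q)) (kernel.lift_ι _ _ _) (σ := pullback.diagonal h)
    (σ' := pullback.diagonal q) (g := g) (by simp) (by simp [ρ])
    (pullback.hom_ext (by simp [ρ]) (by simp [ρ]))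
  have sq : CommSq e u m (kernel.ι (pullback.fst q q) ≫ pullback.snd q q) :=
    ⟨by simp [u, j, ρ, hem]⟩
  refine (IsKernel.of_exists_lift (f := q) ?_ fun T t ht => ?_).isNormalMono
  · rw [← cancel_epi e, reassoc_of% sq.w, ← pullback.condition, kernel.condition_assoc, zero_comp,
      comp_zero, comp_zero]
  · exact ⟨kernel.lift _ (pullback.lift 0 t (by rw [ht, zero_comp])) (by simp) ≫ sq.lift,
      by simp [sq.fac_right]⟩

end ExactForks

section Monadicity

variable {C : Type u₁} [Category.{v₁} C]

section RegularExtensions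

variable [Regular C]

instance : (MorphismProperty.regularEpi C).IsStableUnderComposition where
  comp_mem f g (_ : IsRegularEpi f) (_ : IsRegularEpi g) :=
    inferInstanceAs (IsRegularEpi (f ≫ g))

theorem isPullback_pullback_map_left {E B : C} (p : E ⟶ B)
    {X Y : (MorphismProperty.regularEpi C).Over ⊤ B} (g : X ⟶ Y) :
    IsPullback (pullback.fst X.hom p)
      ((MorphismProperty.Over.pullback (MorphismProperty.regularEpi C) ⊤ p).map g).left
      g.left (pullback.fst Y.hom p) := by
  have hw : (pullback.fst X.hom p ≫ g.left) ≫ Y.hom = pullback.snd X.hom p ≫ p := by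
    rw [Category.assoc, MorphismProperty.Over.w, pullback.condition]
  refine .of_bot ?_ (pullback.lift_fst _ _ hw).symm (.of_hasPullback Y.hom p)
  rw [MorphismProperty.Over.w]
  exact (congrArg (IsPullback (pullback.fst X.hom p) · X.hom p) (pullback.lift_snd _ _ hw)).mpr
    (.of_hasPullback X.hom p)

theorem IsExactFork.nonempty_isColimit_over {B : C}
    {X Y Q : (MorphismProperty.regularEpi C).Over ⊤ B} {f g : X ⟶ Y} {q : Y ⟶ Q}
    (h : IsExactFork f.left g.left q.left) (w : f ≫ q = g ≫ q) :
    Nonempty (IsColimit (Cofork.ofπ q w)) := by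
  have := h.isRegularEpi
  have : Epi q := ⟨fun a b hab => by
    ext
    exact (cancel_epi q.left).1 (congrArg (fun t => t.left) hab)⟩
  have hdesc (s : Cofork f g) : ∃ u : Q ⟶ s.pt, q ≫ u = s.π := by
    obtain ⟨u, hu⟩ := h.exists_desc s.π.left (congrArg (fun t => t.left) s.condition)
    refine ⟨MorphismProperty.Over.homMk u ?_ trivial, by ext; exact hu⟩
    rw [← cancel_epi q.left, reassoc_of% hu, MorphismProperty.Over.w, MorphismProperty.Over.w]
  choose u hu using hdesc
  exact ⟨Cofork.IsColimit.mk _ u hu fun s m hm => by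
    rw [← cancel_epi q, hu]; exact hm⟩

theorem IsExactFork.pullback_map_left {E B : C} (p : E ⟶ B)
    {X Y Q : (MorphismProperty.regularEpi C).Over ⊤ B} {f g : X ⟶ Y} {q : Y ⟶ Q}
    (h : IsExactFork f.left g.left q.left) (w : f ≫ q = g ≫ q) :
    letI G := MorphismProperty.Over.pullback (MorphismProperty.regularEpi C) ⊤ p
    IsExactFork (G.map f).left (G.map g).left (G.map q).left :=
  h.of_isPullback (isPullback_pullback_map_left p f) (isPullback_pullback_map_left p g).w.symm
    (isPullback_pullback_map_left p q) (by
      rw [← MorphismProperty.Comma.comp_left, ← MorphismProperty.Comma.comp_left,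
        ← Functor.map_comp, w, Functor.map_comp])

end RegularExtensions

variable [HasZeroMorphisms C]

theorem isIso_of_isPullback [Homological C] {X Y X' Y' : C} {x : X' ⟶ X} {g' : X' ⟶ Y'}
    {g : X ⟶ Y} {y : Y' ⟶ Y} (sq : IsPullback x g' g y) (hg' : IsIso g') (hy : IsRegularEpi y) :
    IsIso g := by
  have := isRegularEpi_of_isPullback sq
  have : IsRegularEpi (x ≫ g) := by rw [sq.w]; infer_instance
  have := isRegularEpi_of_isRegularEpi_comp x g
  have : Mono g := mono_of_cancel_zero g fun T t ht => by
    obtain ⟨l, rfl, hl⟩ := sq.exists_lift t 0 (by rw [ht, zero_comp])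
    rw [(cancel_mono g').1 (hl.trans zero_comp.symm), zero_comp]
  exact isIso_of_mono_of_strongEpi g

variable [ExactHomological C]

theorem exists_isExactFork_over {B : C} {X Y : (MorphismProperty.regularEpi C).Over ⊤ B}
    (f g : X ⟶ Y) [IsReflexivePair f g] :
    ∃ (Q : (MorphismProperty.regularEpi C).Over ⊤ B) (q : Y ⟶ Q),
      f ≫ q = g ≫ q ∧ IsExactFork f.left g.left q.left := by
  obtain ⟨Q, q, hq⟩ := exists_isExactFork f.left g.left (commonSection f g).left (𝟙 Y.left)
    (congrArg (fun t => t.left) (section_comp_left f g))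
    (congrArg (fun t => t.left) (section_comp_right f g))
  obtain ⟨u, hu⟩ := hq.exists_desc Y.hom (by
    rw [MorphismProperty.Over.w, MorphismProperty.Over.w])
  have : IsRegularEpi (q ≫ u) := hu ▸ Y.prop
  exact ⟨.mk ⊤ u (isRegularEpi_of_isRegularEpi_comp q u), MorphismProperty.Over.homMk q hu trivial,
    by ext; exact hq.w, hq⟩

theorem isMonadicExtension_of_isRegularEpi {E B : C} (p : E ⟶ B) [hp : IsRegularEpi p] :
    IsMonadicExtension p := by
  let G := MorphismProperty.Over.pullback (MorphismProperty.regularEpi C) ⊤ p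
  have : G.ReflectsIsomorphisms := ⟨fun {X Y} g _ => by
    have hGg : IsIso (G.map g).left :=
      (MorphismProperty.Over.forget _ _ _ ⋙ CategoryTheory.Over.forget _).map_isIso (G.map g)
    have := isIso_of_isPullback (isPullback_pullback_map_left p g) hGg
      (isRegularEpi_of_isPullback (.of_hasPullback Y.hom p))
    exact (MorphismProperty.Over.isoMk (asIso g.left) (MorphismProperty.Over.w g)).isIso_hom⟩
  have : HasReflexiveCoequalizers ((MorphismProperty.regularEpi C).Over ⊤ B) := ⟨fun _ _ f g _ => by
    obtain ⟨Q, q, w, hq⟩ := exists_isExactFork_over f g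
    exact ⟨⟨_, (hq.nonempty_isColimit_over w).some⟩⟩⟩
  have : Monad.PreservesColimitOfIsReflexivePair G := ⟨fun _ _ f g _ => by
    obtain ⟨Q, q, w, hq⟩ := exists_isExactFork_over f g
    have hGw : G.map f ≫ G.map q = G.map g ≫ G.map q := by rw [← G.map_comp, w, G.map_comp]
    exact preservesColimit_of_preserves_colimit_cocone (hq.nonempty_isColimit_over w).some
      ((isColimitMapCoconeCoforkEquiv G w).symm
        ((hq.pullback_map_left p w).nonempty_isColimit_over hGw).some)⟩
  exact ⟨hp, ⟨Monad.monadicOfHasPreservesReflexiveCoequalizersOfReflectsIsomorphisms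
    (MorphismProperty.Over.mapPullbackAdj (MorphismProperty.regularEpi C) ⊤ p hp trivial)⟩⟩

end Monadicity

section Reflections

variable {C : Type u₁} [Category.{v₁} C] {D : Type u₂} [Category.{v₂} D] {L : C ⥤ D} {R : D ⥤ C}
  (adj : L ⊣ R)

theorem exists_unitAt_fac {X : C} {V : D} (x : X ⟶ R.obj V) :
    ∃ v : L.obj X ⟶ V, unitAt adj X ≫ R.map v = x :=
  ⟨(adj.homEquiv _ _).symm x, by simp [unitAt, Adjunction.homEquiv_counit]⟩

theorem exists_unitAt_fac_of_essImage {X Y : C} (hY : R.essImage Y) (x : X ⟶ Y) :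
    ∃ v : R.obj (L.obj X) ⟶ Y, unitAt adj X ≫ v = x := by
  obtain ⟨V, ⟨i⟩⟩ := hY
  obtain ⟨v, hv⟩ := exists_unitAt_fac adj (x ≫ i.inv)
  exact ⟨R.map v ≫ i.hom, by rw [reassoc_of% hv, i.inv_hom_id, Category.comp_id]⟩

variable {adj} in
theorem IsRegularEpiReflective.essImage_of_mono [R.Full] [R.Faithful]
    (h : IsRegularEpiReflective adj) {X Y : C} (m : X ⟶ Y) [Mono m] (hY : R.essImage Y) :
    R.essImage X := by
  obtain ⟨v, hv⟩ := exists_unitAt_fac_of_essImage adj hY m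
  have := h.regularEpi_unit X
  have := mono_of_mono_fac hv
  have := isIso_of_mono_of_strongEpi (unitAt adj X)
  exact ⟨_, ⟨(asIso (unitAt adj X)).symm⟩⟩

variable [HasZeroMorphisms C]

theorem comp_eq_zero_of_comp_unitAt_eq_zero {T X Y : C} (hY : R.essImage Y) (x : X ⟶ Y) {t : T ⟶ X}
    (ht : t ≫ unitAt adj X = 0) : t ≫ x = 0 := by
  obtain ⟨v, rfl⟩ := exists_unitAt_fac_of_essImage adj hY x
  rw [reassoc_of% ht, zero_comp]

theorem comp_comp_unitAt_eq_zero {T X Y : C} {t : T ⟶ X} (ht : t ≫ unitAt adj X = 0) (x : X ⟶ Y) :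
    t ≫ x ≫ unitAt adj Y = 0 :=
  comp_eq_zero_of_comp_unitAt_eq_zero adj (R.obj_mem_essImage _) _ ht

theorem comp_eq_zero_of_comp_cokernel_π_unitAt {K T X Y : C} (hY : R.essImage Y) (x : X ⟶ Y)
    {k : K ⟶ X} [HasCokernel k] (hk : k ≫ x = 0) {t : T ⟶ X}
    (ht : t ≫ cokernel.π k ≫ unitAt adj (cokernel k) = 0) : t ≫ x = 0 := by
  rw [← cokernel.π_desc k x hk, ← Category.assoc]
  exact comp_eq_zero_of_comp_unitAt_eq_zero adj hY _ (by rwa [Category.assoc])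

theorem comp_cokernel_π_unitAt_eq_zero_iff {K T X : C} {k : K ⟶ X} [HasCokernel k]
    (hk : k ≫ unitAt adj X = 0) (t : T ⟶ X) :
    t ≫ cokernel.π k ≫ unitAt adj (cokernel k) = 0 ↔ t ≫ unitAt adj X = 0 :=
  ⟨comp_eq_zero_of_comp_cokernel_π_unitAt adj (R.obj_mem_essImage _) _ hk,
    fun ht => comp_comp_unitAt_eq_zero adj ht _⟩

namespace IsTrivialExtension

variable {adj}

theorem eq_zero {T X Y : C} {a : X ⟶ Y} (h : IsTrivialExtension adj a) {t : T ⟶ X}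
    (ht : t ≫ a = 0) (htη : t ≫ unitAt adj X = 0) : t = 0 :=
  h.isPullback.hom_ext (by rw [htη, zero_comp]) (by rw [ht, zero_comp])

theorem of_section [Homological C] [R.Full] [R.Faithful] (hR : IsRegularEpiReflective adj)
    {X Y : C} {a : X ⟶ Y} {s : Y ⟶ X} (hs : s ≫ a = 𝟙 Y)
    (h : ∀ ⦃T : C⦄ (t : T ⟶ X), t ≫ a = 0 → t ≫ unitAt adj X = 0 → t = 0) :
    IsTrivialExtension adj a := by
  have := hR.regularEpi_unit X
  have : IsSplitEpi a := ⟨⟨⟨s, hs⟩⟩⟩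
  let c : X ⟶ pullback (unitAt adj Y) (R.map (L.map a)) :=
    pullback.lift a (unitAt adj X) (unitAt_naturality adj a).symm
  have : IsRegularEpi c := isRegularEpi_pullback_lift_of_section hs (unitAt_naturality adj a).symm
    (unitAt_naturality adj s).symm
  have : Mono c := mono_of_cancel_zero c fun T t ht =>
    h t (by simpa [c] using ht =≫ pullback.fst _ _) (by simpa [c] using ht =≫ pullback.snd _ _)
  have := isIso_of_mono_of_strongEpi c
  exact ⟨inferInstance, .flip (.of_iso_pullback ⟨(unitAt_naturality adj a).symm⟩ (asIso c)
    (by simp [c]) (by simp [c]))⟩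

end IsTrivialExtension

variable {adj} in
theorem IsBirkhoff.isRegularEpi_unitKernelMap [ExactHomological C] [R.Full] [R.Faithful]
    (h : IsBirkhoff adj) {X Y : C} (g : X ⟶ Y) [IsRegularEpi g] :
    IsRegularEpi (unitKernelMap adj g) := by
  -- the quotient of `Y` by the image of `K[η_X]` is also a quotient of the reflection of `X`, so
  -- that it belongs to the Birkhoff subcategory
  have := h.regularEpi_unit X
  have hX := isKernel_kernel_ι (unitAt adj X)
  have := hX.isNormalMono
  let φ := Regular.strongEpiMonoFactorisation (kernel.ι (unitAt adj X) ≫ g)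
  have hφ : IsNormalMono φ.m := isNormalMono_of_image (kernel.ι (unitAt adj X)) g φ.e φ.m φ.fac
  obtain ⟨w, hw⟩ := hX.exists_desc (g ≫ cokernel.π φ.m) (by
    simpa only [Category.assoc, cokernel.condition, comp_zero] using
      (φ.fac =≫ cokernel.π φ.m).symm)
  have : IsRegularEpi (unitAt adj X ≫ w) := by rw [hw]; infer_instance
  have hQ : R.essImage (cokernel φ.m) :=
    h.quotient_closed w (isRegularEpi_of_isRegularEpi_comp (unitAt adj X) w) (R.obj_mem_essImage _)
  obtain ⟨l, hl⟩ := (isKernel_cokernel_π φ.m).exists_lift (kernel.ι (unitAt adj Y))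
    (comp_eq_zero_of_comp_unitAt_eq_zero adj hQ _ (kernel.condition _))
  have hel : unitKernelMap adj g ≫ l = φ.e := by
    rw [← cancel_mono φ.m, Category.assoc, hl, unitKernelMap_comp_ι, φ.fac]
  have := mono_of_mono_fac hl
  have : StrongEpi (unitKernelMap adj g ≫ l) := by rw [hel]; infer_instance
  have := strongEpi_of_strongEpi (unitKernelMap adj g) l
  have := isIso_of_mono_of_strongEpi l
  have : unitKernelMap adj g = φ.e ≫ inv l := (IsIso.eq_comp_inv l).2 hel
  rw [this]
  infer_instance

end Reflections

section Commutators

variable {C : Type u₁} [Category.{v₁} C] [HasZeroMorphisms C]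

theorem IsKernel.comp_prod_lift {K N A B B' : C} {k : K ⟶ A} {f : A ⟶ B} {g : A ⟶ B'}
    [HasBinaryProduct B B'] (hk : IsKernel k f) {n : N ⟶ K} (hn : IsKernel n (k ≫ g)) :
    IsKernel (n ≫ k) (prod.lift f g) := by
  have := hk.mono
  have := hn.mono
  refine .of_exists_lift ?_ fun T t ht => ?_
  · rw [comp_prod_lift_eq_zero_iff, Category.assoc, Category.assoc, hk.w, hn.w, comp_zero]
    exact ⟨rfl, rfl⟩
  · obtain ⟨htf, htg⟩ := (comp_prod_lift_eq_zero_iff t f g).1 ht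
    obtain ⟨l, rfl⟩ := hk.exists_lift t htf
    obtain ⟨l, rfl⟩ := hn.exists_lift l (by rwa [← Category.assoc])
    exact ⟨l, (Category.assoc _ _ _).symm⟩

variable [Homological C] {D : Type u₂} [Category.{v₂} D] {L : C ⥤ D} {R : D ⥤ C} (adj : L ⊣ R)

theorem relativeCommutator.toKernel_ι {A B : C} (f : A ⟶ B) :
    toKernel adj f ≫ kernel.ι f = ι adj f :=
  kernel.lift_ι _ _ _

theorem relativeCommutator.ι_comp_unitAt {A B : C} (f : A ⟶ B) : ι adj f ≫ unitAt adj A = 0 := by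
  rw [ι, Category.assoc, Category.assoc, kernel.condition, comp_zero, comp_zero]

theorem relativeCommutator.toKernel_kernelToPullback {A B : C} (f : A ⟶ B) :
    toKernel adj f ≫ kernelToPullback f f =
      kernel.ι (unitKernelMap adj (pullback.fst f f)) ≫ kernel.ι (unitAt adj (pullback f f)) :=
  pullback.hom_ext (by simp [fst_eq_zero]) (by simp [toKernel_ι, ι_eq])

theorem relativeCommutator.isKernel_toKernel {A B : C} (f : A ⟶ B) :
    IsKernel (toKernel adj f) (kernelToPullback f f ≫ unitAt adj (pullback f f)) := by
  obtain ⟨N⟩ := (isNormalMono_toKernel adj f).normalMono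
  have := mono_of_isLimit_fork N.isLimit
  refine .of_exists_lift ?_ fun T t ht => ?_
  · rw [reassoc_of% toKernel_kernelToPullback adj f, kernel.condition, comp_zero]
  · refine ⟨kernel.lift _ (kernel.lift _ (t ≫ kernelToPullback f f) (by rwa [Category.assoc])) ?_,
      ?_⟩
    · simp [← cancel_mono (kernel.ι (unitAt adj A))]
    · simp [← cancel_mono (kernelToPullback f f), toKernel_kernelToPullback]

open ZeroObject in
theorem selfCommutator.isKernel_ι (A : C) : IsKernel (ι adj A) (unitAt adj A) := by
  have hfac : relativeCommutator.toKernel adj (0 : A ⟶ (0 : C)) ≫ kernel.ι (0 : A ⟶ (0 : C)) =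
    ι adj A := relativeCommutator.toKernel_ι adj _
  have hk := relativeCommutator.isKernel_toKernel adj (0 : A ⟶ (0 : C))
  have := hk.mono
  have : Mono (ι adj A) := hfac ▸ mono_comp _ _
  refine .of_exists_lift (relativeCommutator.ι_comp_unitAt adj _) fun T t ht => ?_
  have ht₀ : kernel.lift (0 : A ⟶ (0 : C)) t (by simp) ≫ kernelToPullback 0 (0 : A ⟶ (0 : C)) =
    t ≫ pullback.lift (0 : A ⟶ A) (𝟙 A) (by simp) := pullback.hom_ext (by simp) (by simp)
  obtain ⟨l, hl⟩ := hk.exists_lift (kernel.lift 0 t (by simp)) (by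
    rw [reassoc_of% ht₀, comp_comp_unitAt_eq_zero adj ht])
  exact ⟨l, by rw [← hfac, reassoc_of% hl, kernel.lift_ι]⟩

theorem relativeCommutator.kernel_ι_fst_comp_eq_snd_comp {A B Q : C} {f : A ⟶ B} {q : A ⟶ Q}
    (hq : ι adj f ≫ q = 0) :
    kernel.ι (unitAt adj (pullback f f)) ≫ pullback.fst f f ≫ q =
      kernel.ι (unitAt adj (pullback f f)) ≫ pullback.snd f f ≫ q := by
  refine eq_of_kernel_of_section (isKernel_kernel_ι (unitKernelMap adj (pullback.fst f f)))
    (unitKernelMap adj (pullback.diagonal f)) ?_ ?_ ?_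
  · simp [← cancel_mono (kernel.ι (unitAt adj A))]
  · rw [reassoc_of% fst_eq_zero adj f, zero_comp]
    simpa [ι_eq] using hq.symm
  · rw [reassoc_of% unitKernelMap_comp_ι adj, reassoc_of% unitKernelMap_comp_ι adj]
    simp

theorem relativeCommutator.ι_comp_eq_zero {A B E : C} {f : A ⟶ B} {p : E ⟶ B}
    (hp : IsTrivialExtension adj (pullback.fst p p)) {h : A ⟶ E} (hf : h ≫ p = f) :
    ι adj f ≫ h = 0 := by
  let y : pullback f f ⟶ pullback p p :=
    pullback.map f f p p h h (𝟙 B) (by simp [hf]) (by simp [hf])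
  have hy : toKernel adj f ≫ kernelToPullback f f ≫ y = 0 := hp.eq_zero
    (by simp [y, reassoc_of% (kernelToPullback_fst f f)])
    (by simpa using
      comp_comp_unitAt_eq_zero adj ((Category.assoc _ _ _).trans (isKernel_toKernel adj f).w) y)
  simpa [y, reassoc_of% (kernelToPullback_snd f f), reassoc_of% (toKernel_ι adj f)] using
    hy =≫ pullback.snd p p

end Commutators

section Centralization

variable {C : Type u₁} [Category.{v₁} C] [HasZeroMorphisms C] [ExactHomological C]
  {D : Type u₂} [Category.{v₂} D] {L : C ⥤ D} {R : D ⥤ C} (adj : L ⊣ R)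

instance relativeCommutator.isNormalMono_ι {A B : C} (f : A ⟶ B) : IsNormalMono (ι adj f) := by
  have hk := isKernel_toKernel adj f
  have := hk.mono
  have : Mono (ι adj f) := toKernel_ι adj f ▸ mono_comp _ _
  have := ((isKernel_kernelToPullback f f).comp_prod_lift hk).isNormalMono
  exact isNormalMono_of_image (toKernel adj f ≫ kernelToPullback f f) (pullback.snd f f) (𝟙 _)
    (ι adj f) (by simp [toKernel_ι])

/-- The centralization `A / [K[f], A] ⟶ B` of `f : A ⟶ B` with respect to a reflection. -/
def centralization {A B : C} (f : A ⟶ B) : cokernel (relativeCommutator.ι adj f) ⟶ B :=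
  cokernel.desc _ f (relativeCommutator.ι_comp adj f)

theorem π_centralization {A B : C} (f : A ⟶ B) :
    cokernel.π (relativeCommutator.ι adj f) ≫ centralization adj f = f :=
  cokernel.π_desc _ _ _

theorem exists_comp_eq_centralization {P B E : C} {f : P ⟶ B} (hf : IsProjectivePresentation f)
    {p : E ⟶ B} (hp : IsNormalExtension adj p) : ∃ u, u ≫ p = centralization adj f := by
  obtain ⟨h, hh⟩ := hf.projective p f hp.monadicExtension.regularEpi
  refine ⟨cokernel.desc _ h (relativeCommutator.ι_comp_eq_zero adj hp.trivial_pullback hh), ?_⟩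
  rw [← cancel_epi (cokernel.π (relativeCommutator.ι adj f)), cokernel.π_desc_assoc, hh,
    π_centralization]

theorem comp_prod_lift_unitAt_eq_zero_iff {P B T : C} (f : P ⟶ B) (t : T ⟶ P) :
    t ≫ prod.lift f (unitAt adj P) = 0 ↔
      t ≫ cokernel.π (relativeCommutator.ι adj f) ≫
        prod.lift (centralization adj f) (unitAt adj _) = 0 := by
  rw [← Category.assoc, comp_prod_lift_eq_zero_iff, comp_prod_lift_eq_zero_iff, Category.assoc,
    Category.assoc, π_centralization,
    comp_cokernel_π_unitAt_eq_zero_iff adj (relativeCommutator.ι_comp_unitAt adj f)]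

end Centralization

section GaloisGroup

variable {C : Type u₁} [Category.{v₁} C]

section

variable [HasZeroMorphisms C] [HasFiniteLimits C]

theorem IsKernel.exists_isKernel_of_isPullback {W X Y Z N V : C} {x : W ⟶ X} {f : W ⟶ Y}
    {g : X ⟶ Z} {y : Y ⟶ Z} (sq : IsPullback x f g y) {b : X ⟶ V} {i : N ⟶ X}
    (hi : IsKernel i (prod.lift g b)) : ∃ m : N ⟶ W, IsKernel m (prod.lift f (x ≫ b)) := by
  have := hi.mono
  obtain ⟨hig, hib⟩ := (comp_prod_lift_eq_zero_iff i g b).1 hi.w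
  let m : N ⟶ W := sq.lift i 0 (by rw [hig, zero_comp])
  have hmx : m ≫ x = i := sq.lift_fst _ _ _
  have hmf : m ≫ f = 0 := sq.lift_snd _ _ _
  have : Mono m := mono_of_mono_fac hmx
  refine ⟨m, .of_exists_lift ?_ fun T t ht => ?_⟩
  · rw [comp_prod_lift_eq_zero_iff, reassoc_of% hmx]
    exact ⟨hmf, hib⟩
  · obtain ⟨htf, htx⟩ := (comp_prod_lift_eq_zero_iff t f (x ≫ b)).1 ht
    obtain ⟨l, hl⟩ := hi.exists_lift (t ≫ x) ((comp_prod_lift_eq_zero_iff _ g b).2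
      ⟨by rw [Category.assoc, sq.w, reassoc_of% htf, zero_comp], by rwa [Category.assoc]⟩)
    exact ⟨l, sq.hom_ext (by rw [Category.assoc, hmx, hl]) (by rw [Category.assoc, hmf, htf,
      comp_zero])⟩

theorem IsKernel.comp_pullback_snd {E B N V : C} {p : E ⟶ B} {g : E ⟶ V} {m : N ⟶ pullback p p}
    (hm : IsKernel m (prod.lift (pullback.fst p p) (pullback.snd p p ≫ g))) :
    IsKernel (m ≫ pullback.snd p p) (prod.lift p g) := by
  have := hm.mono
  obtain ⟨hm₁, hm₂⟩ := (comp_prod_lift_eq_zero_iff _ _ _).1 hm.w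
  have : Mono (m ≫ pullback.snd p p) := ⟨fun a b hab => by
    rw [← cancel_mono m]
    exact pullback.hom_ext (by simp [hm₁]) (by simpa using hab)⟩
  refine .of_exists_lift ?_ fun T t ht => ?_
  · rw [comp_prod_lift_eq_zero_iff, Category.assoc, ← pullback.condition, reassoc_of% hm₁,
      zero_comp, Category.assoc, hm₂]
    exact ⟨rfl, rfl⟩
  · obtain ⟨htp, htg⟩ := (comp_prod_lift_eq_zero_iff t p g).1 ht
    obtain ⟨l, hl⟩ := hm.exists_lift (pullback.lift 0 t (by rw [htp, zero_comp]))
      ((comp_prod_lift_eq_zero_iff _ _ _).2 ⟨by simp, by simpa using htg⟩)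
    exact ⟨l, by rw [reassoc_of% hl, pullback.lift_snd]⟩

end

variable [HasZeroMorphisms C] [Homological C] {D : Type u₂} [Category.{v₂} D] {L : C ⥤ D}
  {R : D ⥤ C} (adj : L ⊣ R)

theorem exists_isKernel_map_galoisGroup [HasZeroMorphisms D] [R.Full] [R.Faithful] {E B : C}
    (p : E ⟶ B) : ∃ ι : R.obj (galoisGroup adj p) ⟶ R.obj (L.obj (pullback p p)),
      IsKernel ι (prod.lift (R.map (L.map (pullback.fst p p)))
        (R.map (L.map (pullback.snd p p)))) := by
  have := hasFiniteLimits_of_adjunction adj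
  have : PreservesLimitsOfSize.{0, 0} R := adj.rightAdjoint_preservesLimits
  have hι := (isKernel_kernel_ι
    (prod.lift (L.map (pullback.fst p p)) (L.map (pullback.snd p p)))).map R
  refine ⟨_, hι.of_comp_eq_zero_iff fun T t => ?_⟩
  rw [← cancel_mono (prodComparison R _ _), Category.assoc, zero_comp]
  congr!
  ext <;> simp [prodComparison, ← R.map_comp]

theorem IsTrivialExtension.exists_isKernel_galoisGroup [HasZeroMorphisms D] [R.Full] [R.Faithful]
    {E B : C} {p : E ⟶ B} (h : IsTrivialExtension adj (pullback.fst p p)) :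
    ∃ n : R.obj (galoisGroup adj p) ⟶ E, IsKernel n (prod.lift p (unitAt adj E)) := by
  obtain ⟨ι, hι⟩ := exists_isKernel_map_galoisGroup adj p
  obtain ⟨m, hm⟩ := hι.exists_isKernel_of_isPullback h.isPullback
  rw [unitAt_naturality] at hm
  exact ⟨_, hm.comp_pullback_snd⟩

theorem IsTrivialExtension.comp_eq_self {E B : C} {p : E ⟶ B}
    (h : IsTrivialExtension adj (pullback.fst p p)) {x : E ⟶ E} (hx : x ≫ p = p) {T : C}
    {t : T ⟶ E} (ht : t ≫ unitAt adj E = 0) : t ≫ x = t := by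
  let y : E ⟶ pullback p p := pullback.lift (𝟙 E) x (by rw [hx, Category.id_comp])
  have hdy : t ≫ pullback.diagonal p = t ≫ y := h.isPullback.hom_ext
    (by rw [Category.assoc, Category.assoc, comp_comp_unitAt_eq_zero adj ht,
      comp_comp_unitAt_eq_zero adj ht])
    (by simp [y])
  simpa [y] using (hdy =≫ pullback.snd p p).symm

namespace IsWeaklyUniversalNormalExtension

variable {adj} {E E' B : C} {p : E ⟶ B} {p' : E' ⟶ B} {N N' : C} {n : N ⟶ E} {n' : N' ⟶ E'}

theorem exists_kernel_hom (hp : IsWeaklyUniversalNormalExtension adj p)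
    (hp' : IsNormalExtension adj p') (hn : IsKernel n (prod.lift p (unitAt adj E)))
    (hn' : IsKernel n' (prod.lift p' (unitAt adj E'))) :
    ∃ (u : E ⟶ E') (a : N ⟶ N'), u ≫ p' = p ∧ a ≫ n' = n ≫ u := by
  obtain ⟨u, hu⟩ := hp.weaklyUniversal p' hp'
  obtain ⟨hnp, hnη⟩ := (comp_prod_lift_eq_zero_iff _ _ _).1 hn.w
  obtain ⟨a, ha⟩ := hn'.exists_lift (n ≫ u) ((comp_prod_lift_eq_zero_iff _ _ _).2
    ⟨by rw [Category.assoc, hu, hnp], by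
      rw [Category.assoc, comp_comp_unitAt_eq_zero adj hnη]⟩)
  exact ⟨u, a, hu, ha⟩

theorem nonempty_iso (hp : IsWeaklyUniversalNormalExtension adj p)
    (hp' : IsWeaklyUniversalNormalExtension adj p')
    (hn : IsKernel n (prod.lift p (unitAt adj E)))
    (hn' : IsKernel n' (prod.lift p' (unitAt adj E'))) : Nonempty (N ≅ N') := by
  obtain ⟨u, a, hu, ha⟩ := hp.exists_kernel_hom hp'.normal hn hn'
  obtain ⟨v, b, hv, hb⟩ := hp'.exists_kernel_hom hp.normal hn' hn
  have := hn.mono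
  have := hn'.mono
  refine ⟨⟨a, b, ?_, ?_⟩⟩
  · rw [← cancel_mono n, Category.assoc, hb, reassoc_of% ha, Category.id_comp]
    exact hp.normal.trivial_pullback.comp_eq_self adj (by rw [Category.assoc, hv, hu])
      ((comp_prod_lift_eq_zero_iff _ _ _).1 hn.w).2
  · rw [← cancel_mono n', Category.assoc, ha, reassoc_of% hb, Category.id_comp]
    exact hp'.normal.trivial_pullback.comp_eq_self adj (by rw [Category.assoc, hu, hv])
      ((comp_prod_lift_eq_zero_iff _ _ _).1 hn'.w).2

end IsWeaklyUniversalNormalExtension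

end GaloisGroup

section Composite

variable {𝒜 : Type*} [Category* 𝒜] {ℬ : Type*} [Category* ℬ] {ℱ : Type*} [Category* ℱ]
  {I : 𝒜 ⥤ ℬ} {H : ℬ ⥤ 𝒜} (adj₁ : I ⊣ H) {F : ℬ ⥤ ℱ} {U : ℱ ⥤ ℬ} (adj₂ : F ⊣ U)

theorem unitAt_comp (X : 𝒜) : unitAt (adj₁.comp adj₂) X =
    unitAt adj₁ X ≫ H.map (unitAt adj₂ (I.obj X)) := by
  simp [unitAt]

theorem comp_unitAt_comp_eq_zero [HasZeroMorphisms 𝒜] {T X : 𝒜} {t : T ⟶ X}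
    (ht : t ≫ unitAt adj₁ X = 0) : t ≫ unitAt (adj₁.comp adj₂) X = 0 := by
  rw [unitAt_comp, reassoc_of% ht, zero_comp]

section Reflective

variable {adj₁ adj₂} [H.Full] [H.Faithful] [Regular 𝒜]

theorem IsBirkhoff.isRegularEpi_map (hℬ : IsBirkhoff adj₁) {Z Z' : ℬ} (g : Z ⟶ Z')
    [IsRegularEpi g] : IsRegularEpi (H.map g) := by
  let φ := Regular.strongEpiMonoFactorisation (H.map g)
  obtain ⟨V, ⟨i⟩⟩ := hℬ.quotient_closed φ.e inferInstance (H.obj_mem_essImage _)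
  obtain ⟨e, he⟩ := H.map_surjective (φ.e ≫ i.inv)
  obtain ⟨m, hm⟩ := H.map_surjective (i.hom ≫ φ.m)
  have hem : e ≫ m = g := H.map_injective (by
    rw [H.map_comp, he, hm, Category.assoc, i.inv_hom_id_assoc, φ.fac])
  have : Mono m := H.mono_of_mono_map (hm ▸ mono_comp _ _)
  have : StrongEpi (e ≫ m) := by rw [hem]; infer_instance
  have := strongEpi_of_strongEpi e m
  have := isIso_of_mono_of_strongEpi m
  have : IsRegularEpi (H.map e) := by rw [he]; infer_instance
  rw [← hem, H.map_comp]
  infer_instance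

theorem IsBirkhoff.isRegularEpiReflective_comp [U.Full] [U.Faithful] (hℬ : IsBirkhoff adj₁)
    (hℱ : IsRegularEpiReflective adj₂) : IsRegularEpiReflective (adj₁.comp adj₂) where
  regularEpi_unit X := by
    have := hℬ.regularEpi_unit X
    have := hℱ.regularEpi_unit (I.obj X)
    have := hℬ.isRegularEpi_map (unitAt adj₂ (I.obj X))
    rw [unitAt_comp]
    infer_instance

end Reflective

section Protoadditive

variable [HasZeroMorphisms 𝒜] [HasZeroMorphisms ℬ] [HasZeroMorphisms ℱ] [Homological 𝒜]
  [H.Full] [H.Faithful]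

theorem IsKernel.isSplitShortExact_of_reflective (adj : I ⊣ H) {Z X Y : ℬ} {z : Z ⟶ X} {a : X ⟶ Y}
    (hz : IsKernel z a) {s : Y ⟶ X} (hs : s ≫ a = 𝟙 Y) : IsSplitShortExact z a s := by
  have : PreservesLimitsOfSize.{0, 0} H := adj.rightAdjoint_preservesLimits
  have : IsSplitEpi a := ⟨⟨⟨s, hs⟩⟩⟩
  have hdesc {G : ℬ} (g : X ⟶ G) (hg : z ≫ g = 0) : a ≫ s ≫ g = g := by
    obtain ⟨l, hl⟩ := (hz.map H).exists_desc (H.map g) (by rw [← H.map_comp, hg, H.map_zero])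
    obtain ⟨l, rfl⟩ := H.map_surjective l
    obtain rfl : a ≫ l = g := H.map_injective (by rw [H.map_comp, hl])
    rw [reassoc_of% hs]
  exact { w := hz.w, isKernel := hz.isLimit, splitting := hs
          isCokernel := ⟨CokernelCofork.IsColimit.ofπ' a hz.w fun g hg => ⟨s ≫ g, hdesc g hg⟩⟩ }

theorem IsRegularEpiReflective.exists_isRegularEpi_kernel_comp_unitAt {adj : I ⊣ H}
    (hℬ : IsRegularEpiReflective adj) {X Y K : 𝒜} {a : X ⟶ Y} {s : Y ⟶ X} (hs : s ≫ a = 𝟙 Y)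
    {κ : K ⟶ X} (hκ : IsKernel κ a) {Z : ℬ} {z : Z ⟶ I.obj X} (hz : IsKernel z (I.map a)) :
    ∃ e : K ⟶ H.obj Z, IsRegularEpi e ∧ e ≫ H.map z = κ ≫ unitAt adj X := by
  have : PreservesLimitsOfSize.{0, 0} H := adj.rightAdjoint_preservesLimits
  have := hℬ.regularEpi_unit X
  obtain ⟨e, he⟩ := (hz.map H).exists_lift (κ ≫ unitAt adj X) (by
    rw [Category.assoc, unitAt_naturality, reassoc_of% hκ.w, zero_comp])
  exact ⟨e, hκ.isRegularEpi_of_section (hz.map H) he hs (unitAt_naturality adj a).symm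
    (unitAt_naturality adj s).symm, he⟩

include adj₁ in
theorem IsProtoadditive.comp_map_unitAt_eq_zero (hproto : IsProtoadditive F) {X Y Z : ℬ}
    {a : X ⟶ Y} {s : Y ⟶ X} (hs : s ≫ a = 𝟙 Y) {z : Z ⟶ X} (hz : IsKernel z a) {T : 𝒜}
    {t : T ⟶ H.obj Z} (ht : t ≫ H.map (z ≫ unitAt adj₂ X) = 0) :
    t ≫ H.map (unitAt adj₂ Z) = 0 := by
  have hF : IsKernel (F.map z) (F.map a) :=
    have h := hproto _ _ _ (hz.isSplitShortExact_of_reflective adj₁ hs)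
    ⟨h.w, h.isKernel⟩
  have := hF.mono
  have : (U ⋙ H).PreservesMonomorphisms :=
    Functor.preservesMonomorphisms_of_adjunction (adj₁.comp adj₂)
  rw [← cancel_mono ((U ⋙ H).map (F.map z)), zero_comp, Category.assoc, Functor.comp_map,
    ← H.map_comp, unitAt_naturality, ht]

theorem IsProtoadditive.comp_eq_zero (hproto : IsProtoadditive F)
    (hℬ : IsRegularEpiReflective adj₁) {K X Y V : 𝒜} {a : X ⟶ Y} {s : Y ⟶ X} (hs : s ≫ a = 𝟙 Y)
    {κ : K ⟶ X} (hκ : IsKernel κ a) (hV : (U ⋙ H).essImage V) {w : K ⟶ V}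
    (hw : ∀ ⦃T : 𝒜⦄ (t : T ⟶ K), t ≫ κ ≫ unitAt adj₁ X = 0 → t ≫ w = 0) {T : 𝒜} {t : T ⟶ K}
    (ht : t ≫ κ ≫ unitAt (adj₁.comp adj₂) X = 0) : t ≫ w = 0 := by
  have := hasFiniteLimits_of_adjunction adj₁
  obtain ⟨V, ⟨i⟩⟩ := hV
  have hs' : I.map s ≫ I.map a = 𝟙 (I.obj Y) := by rw [← I.map_comp, hs, I.map_id]
  have hz := isKernel_kernel_ι (I.map a)
  obtain ⟨e, _, he⟩ := hℬ.exists_isRegularEpi_kernel_comp_unitAt hs hκ hz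
  obtain ⟨w', hw'⟩ := (isKernel_kernel_ι e).exists_desc (w ≫ i.inv) (by
    rw [← Category.assoc, hw _ (by rw [← he, kernel.condition_assoc, zero_comp]), zero_comp])
  obtain ⟨w', rfl⟩ := H.map_surjective w'
  obtain ⟨v, rfl⟩ := exists_unitAt_fac adj₂ w'
  have hte : (t ≫ e) ≫ H.map (unitAt adj₂ _) = 0 :=
    hproto.comp_map_unitAt_eq_zero adj₁ adj₂ hs' hz (by
      rw [H.map_comp, Category.assoc, reassoc_of% he, ← unitAt_comp, ht])
  rw [← cancel_mono i.inv, Category.assoc, ← hw', H.map_comp, ← Category.assoc,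
    ← Category.assoc (t ≫ e), hte, zero_comp, zero_comp]

end Protoadditive

section Closure

theorem isKernel_closure_arrow {C : Type u₁} [Category.{v₁} C] [HasZeroMorphisms C] [Homological C]
    {D : Type u₂} [Category.{v₂} D] {L : C ⥤ D} {R : D ⥤ C} (adj : L ⊣ R) {K A : C} (k : K ⟶ A)
    [IsNormalMono k] :
    IsKernel (closure adj k).arrow (cokernel.π k ≫ unitAt adj (cokernel k)) := by
  have sq := Subobject.isPullback (cokernel.π k) (kernelSubobject (unitAt adj (cokernel k)))
  have hk := isKernel_kernelSubobject_arrow (unitAt adj (cokernel k))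
  refine .of_exists_lift ?_ fun T t ht => ?_
  · rw [closure, ← sq.w_assoc, hk.w, comp_zero]
  · obtain ⟨l, hl⟩ := hk.exists_lift (t ≫ cokernel.π k) (by rwa [Category.assoc])
    exact ⟨sq.lift l t hl, sq.lift_snd _ _ _⟩

theorem IsKernel.inf_arrow {C : Type u₁} [Category.{v₁} C] [HasZeroMorphisms C] [HasFiniteLimits C]
    {A B B' : C} {f : A ⟶ B} {g : A ⟶ B'} {S T : Subobject A} (hS : IsKernel S.arrow f)
    (hT : IsKernel T.arrow g) : IsKernel (S ⊓ T).arrow (prod.lift f g) := by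
  refine .of_exists_lift ?_ fun V t ht => ?_
  · rw [comp_prod_lift_eq_zero_iff]
    nth_rewrite 1 [← Subobject.ofLE_arrow (inf_le_left : S ⊓ T ≤ S)]
    rw [← Subobject.ofLE_arrow (inf_le_right : S ⊓ T ≤ T), Category.assoc, Category.assoc, hS.w,
      hT.w, comp_zero, comp_zero]
    exact ⟨rfl, rfl⟩
  · obtain ⟨htf, htg⟩ := (comp_prod_lift_eq_zero_iff t f g).1 ht
    obtain ⟨a, ha⟩ := hS.exists_lift t htf
    obtain ⟨b, hb⟩ := hT.exists_lift t htg
    have ht : (S ⊓ T).Factors t := (Subobject.inf_factors t).2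
      ⟨(Subobject.factors_iff _ _).2 ⟨a, ha⟩, (Subobject.factors_iff _ _).2 ⟨b, hb⟩⟩
    exact ⟨(S ⊓ T).factorThru t ht, Subobject.factorThru_arrow _ _ _⟩

theorem IsKernel.eq_mk {C : Type u₁} [Category.{v₁} C] [HasZeroMorphisms C] {K A B : C}
    {f : A ⟶ B} {S : Subobject A} (hS : IsKernel S.arrow f) {k : K ⟶ A} [Mono k]
    (hk : IsKernel k f) : S = Subobject.mk k := by
  obtain ⟨a, ha⟩ := hk.exists_lift S.arrow hS.w
  obtain ⟨b, hb⟩ := hS.exists_lift k hk.w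
  exact le_antisymm (Subobject.le_mk_of_comm a ha) (Subobject.mk_le_of_comm b hb)

end Closure

end Composite

section Normality

section

variable {C : Type u₁} [Category.{v₁} C] [HasZeroMorphisms C] [ExactHomological C]
  {D : Type u₂} [Category.{v₂} D] {L : C ⥤ D} {R : D ⥤ C} (adj : L ⊣ R)

instance isRegularEpi_centralization {P B : C} (f : P ⟶ B) [IsRegularEpi f] :
    IsRegularEpi (centralization adj f) := by
  have : IsRegularEpi (cokernel.π (relativeCommutator.ι adj f) ≫ centralization adj f) := by
    rwa [π_centralization]
  exact isRegularEpi_of_isRegularEpi_comp (cokernel.π (relativeCommutator.ι adj f)) _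

theorem comp_kernel_ι_cokernel_π_eq_zero_iff {P B T : C} (f : P ⟶ B) (t : T ⟶ kernel f) :
    t ≫ kernel.ι f ≫ cokernel.π (relativeCommutator.ι adj f) = 0 ↔
      t ≫ kernelToPullback f f ≫ unitAt adj (pullback f f) = 0 := by
  have hk := relativeCommutator.isKernel_toKernel adj f
  constructor <;> intro ht
  · obtain ⟨l, hl⟩ := (isKernel_cokernel_π (relativeCommutator.ι adj f)).exists_lift
      (t ≫ kernel.ι f) (by rwa [Category.assoc])
    rw [← relativeCommutator.toKernel_ι, ← Category.assoc, cancel_mono] at hl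
    rw [← hl, Category.assoc, hk.w, comp_zero]
  · obtain ⟨l, rfl⟩ := hk.exists_lift t ht
    rw [Category.assoc, reassoc_of% relativeCommutator.toKernel_ι adj f, cokernel.condition,
      comp_zero]

variable {adj} in
theorem IsRegularEpiReflective.essImage_kernel_centralization [R.Full] [R.Faithful]
    (hR : IsRegularEpiReflective adj) {P B : C} (f : P ⟶ B) :
    R.essImage (kernel (centralization adj f)) := by
  let π := cokernel.π (relativeCommutator.ι adj f)
  let r : kernel f ⟶ kernel (centralization adj f) :=
    kernel.map _ _ π (𝟙 B) (by rw [π_centralization, Category.comp_id])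
  have hr : r ≫ kernel.ι _ = kernel.ι f ≫ π := kernel.lift_ι _ _ _
  have hf : IsKernel (kernel.ι f) (π ≫ centralization adj f) := by
    rw [π_centralization]
    exact isKernel_kernel_ι f
  have : IsRegularEpi r := hf.isRegularEpi_of_comp (isKernel_kernel_ι _) hr
  obtain ⟨m, _, -⟩ := exists_mono_fac_of_comp_eq_zero_iff r
    (kernelToPullback f f ≫ unitAt adj (pullback f f)) fun T t => by
      rw [← comp_kernel_ι_cokernel_π_eq_zero_iff, ← hr, ← Category.assoc, ← cancel_mono
        (kernel.ι (centralization adj f)), zero_comp]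
  exact hR.essImage_of_mono m (R.obj_mem_essImage _)

variable {adj} in
theorem IsBirkhoff.comp_fst_eq_comp_snd [R.Full] [R.Faithful] (hR : IsBirkhoff adj) {P E B : C}
    {f : P ⟶ B} {q : P ⟶ E} [hq_reg : IsRegularEpi q] {p : E ⟶ B} (hqp : q ≫ p = f)
    (hq : relativeCommutator.ι adj f ≫ q = 0) {T : C} {t : T ⟶ pullback p p}
    (ht : t ≫ unitAt adj (pullback p p) = 0) : t ≫ pullback.fst p p = t ≫ pullback.snd p p := by
  let φ : pullback f f ⟶ pullback p p :=
    pullback.map f f p p q q (𝟙 B) (by simp [hqp]) (by simp [hqp])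
  have : IsRegularEpi φ := MorphismProperty.pullbackMap (P := .regularEpi C) hq_reg hq_reg hqp.symm
    hqp.symm
  have := hR.isRegularEpi_unitKernelMap φ
  have h : kernel.ι (unitAt adj (pullback p p)) ≫ pullback.fst p p =
      kernel.ι (unitAt adj (pullback p p)) ≫ pullback.snd p p := by
    rw [← cancel_epi (unitKernelMap adj φ), reassoc_of% unitKernelMap_comp_ι adj φ,
      reassoc_of% unitKernelMap_comp_ι adj φ]
    simpa [φ] using relativeCommutator.kernel_ι_fst_comp_eq_snd_comp adj hq
  simpa using kernel.lift _ t ht ≫= h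

end

variable {𝒜 : Type*} [Category* 𝒜] [HasZeroMorphisms 𝒜] [ExactHomological 𝒜]
  {ℬ : Type*} [Category* ℬ] [HasZeroMorphisms ℬ] {ℱ : Type*} [Category* ℱ] [HasZeroMorphisms ℱ]
  {I : 𝒜 ⥤ ℬ} {H : ℬ ⥤ 𝒜} [H.Full] [H.Faithful] {adj₁ : I ⊣ H}
  {F : ℬ ⥤ ℱ} {U : ℱ ⥤ ℬ} [U.Full] [U.Faithful] {adj₂ : F ⊣ U}

theorem IsProtoadditive.isTrivialExtension_of_section (hproto : IsProtoadditive F)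
    (hℬ : IsBirkhoff adj₁) (hℱ : IsRegularEpiReflective adj₂) {K X Y : 𝒜} {a : X ⟶ Y} {s : Y ⟶ X}
    (hs : s ≫ a = 𝟙 Y) {κ : K ⟶ X} (hκ : IsKernel κ a) (hK : (U ⋙ H).essImage K)
    (h : ∀ ⦃T : 𝒜⦄ (t : T ⟶ X), t ≫ a = 0 → t ≫ unitAt adj₁ X = 0 → t = 0) :
    IsTrivialExtension (adj₁.comp adj₂) a := by
  refine .of_section (hℬ.isRegularEpiReflective_comp hℱ) hs fun T t hta htη => ?_
  have := hκ.mono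
  obtain ⟨l, rfl⟩ := hκ.exists_lift t hta
  have hl : l ≫ 𝟙 K = 0 := hproto.comp_eq_zero adj₁ adj₂ hℬ.toIsRegularEpiReflective hs hκ hK
    (fun T t ht => by
      rw [Category.comp_id, ← cancel_mono κ, zero_comp]
      exact h _ (by rw [Category.assoc, hκ.w, comp_zero]) (by rwa [Category.assoc]))
    (by rwa [← Category.assoc])
  rw [(Category.comp_id l).symm.trans hl, zero_comp]

theorem isNormalExtension_centralization (hℬ : IsBirkhoff adj₁) (hℱ : IsRegularEpiReflective adj₂)
    (hproto : IsProtoadditive F) {P B : 𝒜} (f : P ⟶ B) [IsRegularEpi f] :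
    IsNormalExtension (adj₁.comp adj₂) (centralization (adj₁.comp adj₂) f) where
  monadicExtension := isMonadicExtension_of_isRegularEpi _
  trivial_pullback := by
    refine hproto.isTrivialExtension_of_section hℬ hℱ (pullback.diagonal_fst _)
      (isKernel_kernelToPullback _ _)
      ((hℬ.isRegularEpiReflective_comp hℱ).essImage_kernel_centralization f) fun T t ht htη => ?_
    have hq : relativeCommutator.ι adj₁ f ≫
        cokernel.π (relativeCommutator.ι (adj₁.comp adj₂) f) = 0 := by
      rw [← relativeCommutator.toKernel_ι adj₁ f, Category.assoc,
        comp_kernel_ι_cokernel_π_eq_zero_iff, ← Category.assoc]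
      exact comp_unitAt_comp_eq_zero adj₁ adj₂
        ((Category.assoc _ _ _).trans (relativeCommutator.isKernel_toKernel adj₁ f).w)
    exact pullback.hom_ext (by rw [ht, zero_comp]) (by
      rw [← hℬ.comp_fst_eq_comp_snd (π_centralization _ f) hq htη, ht, zero_comp])

end Normality

section HopfFormula

variable {𝒜 : Type*} [Category* 𝒜] [HasZeroMorphisms 𝒜] {ℬ : Type*} [Category* ℬ]
  {ℱ : Type*} [Category* ℱ] {I : 𝒜 ⥤ ℬ} {H : ℬ ⥤ 𝒜} (adj₁ : I ⊣ H) {F : ℬ ⥤ ℱ} {U : ℱ ⥤ ℬ}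
  (adj₂ : F ⊣ U)

theorem isKernel_closure_selfCommutator_arrow [Homological 𝒜] (P : 𝒜) :
    IsKernel (closure (adj₁.comp adj₂) (selfCommutator.ι adj₁ P)).arrow
      (unitAt (adj₁.comp adj₂) P) :=
  (isKernel_closure_arrow _ _).of_comp_eq_zero_iff fun _ t =>
    comp_cokernel_π_unitAt_eq_zero_iff (adj₁.comp adj₂)
      (comp_unitAt_comp_eq_zero adj₁ adj₂ (selfCommutator.isKernel_ι adj₁ P).w) t

theorem isKernel_hopfNumerator_arrow [ExactHomological 𝒜] {P B : 𝒜} (f : P ⟶ B) :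
    IsKernel (hopfNumerator adj₁ (adj₁.comp adj₂) f).arrow
      (cokernel.π (relativeCommutator.ι (adj₁.comp adj₂) f) ≫
        prod.lift (centralization (adj₁.comp adj₂) f) (unitAt (adj₁.comp adj₂) _)) :=
  ((isKernel_kernelSubobject_arrow f).inf_arrow
    (isKernel_closure_selfCommutator_arrow adj₁ adj₂ P)).of_comp_eq_zero_iff fun _ t =>
      comp_prod_lift_unitAt_eq_zero_iff _ f t

variable [HasZeroMorphisms ℬ] [HasZeroMorphisms ℱ] [H.Full] [H.Faithful] {adj₁}

theorem IsProtoadditive.isKernel_closure_toKernel_arrow [Homological 𝒜]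
    (hproto : IsProtoadditive F) (hℬ : IsRegularEpiReflective adj₁) {P B : 𝒜} (f : P ⟶ B) :
    IsKernel (closure (adj₁.comp adj₂) (relativeCommutator.toKernel adj₁ f)).arrow
      (kernelToPullback f f ≫ unitAt (adj₁.comp adj₂) (pullback f f)) := by
  have hk := relativeCommutator.isKernel_toKernel adj₁ f
  refine (isKernel_closure_arrow _ _).of_comp_eq_zero_iff fun T t => ⟨fun ht => ?_, fun ht => ?_⟩
  · refine comp_eq_zero_of_comp_cokernel_π_unitAt _ ((U ⋙ H).obj_mem_essImage _) _ ?_ ht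
    rw [← Category.assoc]
    exact comp_unitAt_comp_eq_zero adj₁ adj₂ ((Category.assoc _ _ _).trans hk.w)
  · refine hproto.comp_eq_zero adj₁ adj₂ hℬ (pullback.diagonal_fst f)
      (isKernel_kernelToPullback f f) ((U ⋙ H).obj_mem_essImage _) (fun T t ht => ?_) ht
    obtain ⟨l, rfl⟩ := hk.exists_lift t ht
    rw [Category.assoc, cokernel.condition_assoc, zero_comp, comp_zero]

theorem IsProtoadditive.isKernel_hopfDenominator_arrow [ExactHomological 𝒜]
    (hproto : IsProtoadditive F) (hℬ : IsRegularEpiReflective adj₁) {P B : 𝒜} (f : P ⟶ B) :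
    IsKernel (hopfDenominator adj₁ (adj₁.comp adj₂) f).arrow
      (cokernel.π (relativeCommutator.ι (adj₁.comp adj₂) f)) := by
  have hk := relativeCommutator.isKernel_toKernel (adj₁.comp adj₂) f
  have hc := isKernel_cokernel_π (relativeCommutator.ι (adj₁.comp adj₂) f)
  have := hk.mono
  have := hc.mono
  have heq : hopfDenominator adj₁ (adj₁.comp adj₂) f =
      Subobject.mk (relativeCommutator.ι (adj₁.comp adj₂) f) := by
    rw [hopfDenominator, (hproto.isKernel_closure_toKernel_arrow adj₂ hℬ f).eq_mk hk,
      Subobject.map_mk]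
    simp only [relativeCommutator.toKernel_ι]
  rw [heq]
  exact hc.arrow_mk

theorem isWeaklyUniversalNormalExtension_centralization [ExactHomological 𝒜] [U.Full] [U.Faithful]
    (hℬ : IsBirkhoff adj₁) {adj₂ : F ⊣ U} (hℱ : IsRegularEpiReflective adj₂)
    (hproto : IsProtoadditive F) {P B : 𝒜} {f : P ⟶ B} (hf : IsProjectivePresentation f) :
    IsWeaklyUniversalNormalExtension (adj₁.comp adj₂) (centralization (adj₁.comp adj₂) f) :=
  have := hf.regularEpi
  ⟨isNormalExtension_centralization hℬ hℱ hproto f,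
    fun _ _ hp => exists_comp_eq_centralization _ hf hp⟩

end HopfFormula

end

end SemiAbelianHopf

open SemiAbelianHopf in
theorem theorem7p5_general
    {𝒜 : Type*} [Category* 𝒜] [HasZeroMorphisms 𝒜] [ExactHomological 𝒜]
    {ℬ : Type*} [Category* ℬ] [HasZeroMorphisms ℬ]
    {ℱ : Type*} [Category* ℱ] [HasZeroMorphisms ℱ]
    {I : 𝒜 ⥤ ℬ} {H : ℬ ⥤ 𝒜} [H.Full] [H.Faithful] (adj₁ : I ⊣ H) (hℬ : IsBirkhoff adj₁)
    {F : ℬ ⥤ ℱ} {U : ℱ ⥤ ℬ} [U.Full] [U.Faithful] (adj₂ : F ⊣ U)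
    (hℱ : IsRegularEpiReflective adj₂) (hproto : IsProtoadditive F)
    {P B : 𝒜} (f : P ⟶ B) (hf : IsProjectivePresentation f) :
    (∃ (E : 𝒜) (p : E ⟶ B), IsWeaklyUniversalNormalExtension (adj₁.comp adj₂) p) ∧
    ∃ (hle : hopfDenominator adj₁ (adj₁.comp adj₂) f ≤ hopfNumerator adj₁ (adj₁.comp adj₂) f)
      (_ : IsNormalMono (Subobject.ofLE _ _ hle)),
      ∀ ⦃E : 𝒜⦄ (p : E ⟶ B), IsWeaklyUniversalNormalExtension (adj₁.comp adj₂) p →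
        Nonempty ((U ⋙ H).obj (galoisGroup (adj₁.comp adj₂) p) ≅
          cokernel (Subobject.ofLE _ _ hle)) := by
  have hD := hproto.isKernel_hopfDenominator_arrow adj₂ hℬ.toIsRegularEpiReflective f
  have hN := isKernel_hopfNumerator_arrow adj₁ adj₂ f
  obtain ⟨l, hl⟩ := hN.exists_lift _ (by rw [reassoc_of% hD.w, zero_comp])
  have hle := Subobject.le_of_comm l hl
  have hc := isWeaklyUniversalNormalExtension_centralization hℬ hℱ hproto hf
  obtain ⟨n, hn⟩ := hc.normal.trivial_pullback.exists_isKernel_galoisGroup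
  obtain ⟨hnormal, ⟨i⟩⟩ := nonempty_iso_cokernel_ofLE hD hN hn hle
  refine ⟨⟨_, _, hc⟩, hle, hnormal, fun E p hp => ?_⟩
  obtain ⟨n', hn'⟩ := hp.normal.trivial_pullback.exists_isKernel_galoisGroup
  obtain ⟨j⟩ := hp.nonempty_iso hc hn' hn
  exact ⟨j ≪≫ i⟩

open SemiAbelianHopf in
theorem theorem7p5
    {𝒜 : Type*} [Category* 𝒜] [HasZeroMorphisms 𝒜] [SemiAbelian 𝒜]
    {ℬ : Type*} [Category* ℬ] [HasZeroMorphisms ℬ]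
    {ℱ : Type*} [Category* ℱ] [HasZeroMorphisms ℱ]
    {I : 𝒜 ⥤ ℬ} {H : ℬ ⥤ 𝒜} [H.Full] [H.Faithful] (adj₁ : I ⊣ H) (hℬ : IsBirkhoff adj₁)
    {F : ℬ ⥤ ℱ} {U : ℱ ⥤ ℬ} [U.Full] [U.Faithful] (adj₂ : F ⊣ U)
    (hℱ : IsRegularEpiReflective adj₂) (hadm : IsAdmissible adj₂) (hproto : IsProtoadditive F)
    {P B : 𝒜} (f : P ⟶ B) (hf : IsProjectivePresentation f) :
    (∃ (E : 𝒜) (p : E ⟶ B), IsWeaklyUniversalNormalExtension (adj₁.comp adj₂) p) ∧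
    ∃ (hle : hopfDenominator adj₁ (adj₁.comp adj₂) f ≤ hopfNumerator adj₁ (adj₁.comp adj₂) f)
      (_ : IsNormalMono (Subobject.ofLE _ _ hle)),
      ∀ ⦃E : 𝒜⦄ (p : E ⟶ B), IsWeaklyUniversalNormalExtension (adj₁.comp adj₂) p →
        Nonempty ((U ⋙ H).obj (galoisGroup (adj₁.comp adj₂) p) ≅
          cokernel (Subobject.ofLE _ _ hle)) :=
  have := exactHomological_of_semiAbelian 𝒜
  theorem7p5_general adj₁ hℬ adj₂ hℱ hproto f hf
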